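/- **Corollary 1 (robustness of the IPA state derivatives).** *Known data.* Fix $T>0$, targets $w_1,\dots,w_M\in\mathbb R^2$, a base $w_B\in\mathbb R^2$, ranges $r_{ij},r_{Bj}$ with $\|w_i-w_B\|>r_{ij}+r_{Bj}$, and maximal collection and delivery rates $\mu_{ij},\beta_{ij}\ge 0$ ($i=1,\dots,M$, $j=1,\dots,N$). Agent $j$ moves along $s_j(t)=(f_j(\Theta_j,\rho_j(t)),g_j(\Theta_j,\rho_j(t)))$, where $\Theta=[\Theta_1,\dots,\Theta_N]$ is the controllable parameter vector, $\Theta_j\in\mathbb R^{d_j}$, and $\rho_j$ may depend on $\Theta_j$; $s_j$ is continuous in $t$ and, near the observed parameter value $\Theta^0$, Lipschitz in $\Theta$ uniformly in $t\in[0,T]$. Put $D_{ij}(t)=\|w_i-s_j(t)\|$, $D_{Bj}(t)=\|w_B-s_j(t)\|$, $D_{ij}^+=\max(0,D_{ij}-r_{ij})$, $D_{Bj}^+=\max(0,D_{Bj}-r_{Bj})$. The rates $P_{ij}(t)=p_{ij}(D_{ij}(t))$ and $P_{Bj}(t)=p_{Bj}(D_{Bj}(t))$ are non-increasing and continuous functions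 of the distance that vanish when the distance exceeds $r_{ij}$, resp. $r_{Bj}$, and $p_{ij}$ is Lipschitz. At each time at most one agent is connected to target $i$; it is within range of $i$ and stays connected as long as it remains within range; and if no agent enters or leaves the range of $i$ at time $t$ under $\Theta^0$, then the connection to $i$ is constant near $(\Theta^0,t)$. The connections are determined by $\Theta$ and $t$, not by the arrivals. *Dynamics.* Let $\sigma_1,\dots,\sigma_M\ge 0$ be random arrival rate processes on a probability space, with piecewise continuous paths on $[0,T]$. For every $\Theta$ in a neighbourhood of $\Theta^0$ the queue contents $X_i,Z_{ij},Y_i\ge 0$ are continuous in $t$, start from given initial values that are functions of $\Theta$ differentiable at $\Theta^0$, and satisfy, except at finitely many times, $$\dot X_i=\begin{cases}0&\text{if }X_i=0,\ \sigma_i\le\mu_{ij}P_{ij}\\ \sigma_i-\mu_{ij}P_{ij}&\text{otherwise}\end{cases}\qquad \dot Z_{ij}=\begin{cases}0&\text{if }Z_{ij}=0,\ \tilde\mu_{ij}P_{ij}-\beta_{ij}P_{Bj}\le 0\\ \tilde\mu_{ij}P_{ij}-\beta_{ij}P_{Bj}&\text{otherwise}\end{cases}$$ $$\dot Y_i=\sum_{j}\beta_{ij}P_{Bj}\mathbf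 1[Z_{ij}>0],$$ where in the first equation $j$ is the agent connected to $i$ (with $\mu_{ij}P_{ij}$ replaced by $0$ if there is none), and $\tilde\mu_{ij}=\min(\sigma_i/P_{ij},\mu_{ij})$ if $j$ is connected to $i$, $X_i=0$ and $P_{ij}>0$; $\tilde\mu_{ij}=\mu_{ij}$ if $j$ is connected to $i$ otherwise; $\tilde\mu_{ij}=0$ if $j$ is not connected to $i$. *Events.* A function hits $0$ at $\tau$ if it is positive just before $\tau$ and zero at $\tau$; it leaves $0$ at $\tau$ if it is zero at $\tau$ and positive just after $\tau$. The observed events under $\Theta^0$ are: $X_i$ hits or leaves $0$; $Z_{ij}$ hits $0$; $Z_{ij}$ leaves $0$ while $X_i=0$; $D_{ij}^+$ hits or leaves $0$; $D_{Bj}^+$ hits or leaves $0$. Assume that, with probability one, there are finitely many events in $[0,T]$, that no two distinct events (other than "$Z_{ij}$ leaves $0$ while $X_i=0$") occur at the same time, and that at every $t\in[0,T]$ that is not an event time $X_i(t)$ and $Z_{ij}(t)$ are differentiable with respect to $\Theta$ at $\Theta^0$. *Claim.* The state derivatives $X_i'(t)$, $Z_{ij}'(t)$, $Y_i'(t)$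 with respect to $\Theta$ at $\Theta^0$ are independent of the arrival processes $\{\sigma_i(t)\}$, except through the observed event times. That is, there are maps $\Phi^X_i,\Phi^Z_{ij},\Phi^Y_i$, determined by the known data and $\Theta^0$ alone, such that for every probability space and all arrival processes and queue contents as above, with probability one, for every $t\in[0,T]$ that is not an event time, $X_i(t)$, $Z_{ij}(t)$ and $Y_i(t)$ are differentiable with respect to $\Theta$ at $\Theta^0$ and $$X_i'(t)=\Phi^X_i(\mathcal E,t),\qquad Z_{ij}'(t)=\Phi^Z_{ij}(\mathcal E,t),\qquad Y_i'(t)=\Phi^Y_i(\mathcal E,t),$$ where $\mathcal E$ is the record of the times at which each of the events occurs on the observed sample path. -/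

import Mathlib

open Set Filter Topology MeasureTheory

noncomputable section

namespace DataHarvesting

/-- The plane containing the mission space. -/
abbrev Plane : Type := EuclideanSpace ℝ (Fin 2)

/-- The parameter vector `Θ = [Θ₁, …, Θ_N]`, where `Θ_j` has `d j` real components. -/
abbrev Params {N : ℕ} (d : Fin N → ℕ) : Type := ∀ j : Fin N, EuclideanSpace ℝ (Fin (d j))

/-- The known (deterministic) data of a harvesting problem with `M` targets and `N` agents. -/
structure Setting (M N : ℕ) (d : Fin N → ℕ) where
  /-- target locations -/
  w : Fin M → Plane
  /-- base location -/
  wB : Plane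
  /-- collection ranges -/
  r : Fin M → Fin N → ℝ
  /-- delivery ranges -/
  rB : Fin N → ℝ
  /-- collection rate, as a function of the distance between target and agent -/
  p : Fin M → Fin N → ℝ → ℝ
  /-- delivery rate, as a function of the distance between base and agent -/
  pB : Fin N → ℝ → ℝ
  /-- maximal collection rates -/
  μ : Fin M → Fin N → ℝ
  /-- maximal delivery rates -/
  β : Fin M → Fin N → ℝ
  /-- `f`, `g`, `ρ` parametrize the trajectories:
  `s_j(t) = (f(Θ_j, ρ_j(t)), g(Θ_j, ρ_j(t)))`, where `ρ_j` may itself depend on `Θ_j` -/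
  f : ∀ j : Fin N, EuclideanSpace ℝ (Fin (d j)) → ℝ → ℝ
  g : ∀ j : Fin N, EuclideanSpace ℝ (Fin (d j)) → ℝ → ℝ
  ρ : ∀ j : Fin N, EuclideanSpace ℝ (Fin (d j)) → ℝ → ℝ
  /-- the agent (at most one) that is connected to target `i` at time `t` -/
  conn : Params d → ℝ → Fin M → Option (Fin N)
  /-- initial contents of the queues -/
  x₀ : Fin M → Params d → ℝ
  z₀ : Fin M → Fin N → Params d → ℝ
  y₀ : Fin M → Params d → ℝ

/-- `h` hits `0` at time `τ`: it is positive just before `τ` and zero at `τ`. -/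
def HitsZero (T : ℝ) (h : ℝ → ℝ) (τ : ℝ) : Prop :=
  0 < τ ∧ τ ≤ T ∧ h τ = 0 ∧ ∀ᶠ u in 𝓝[<] τ, 0 < h u

/-- `h` leaves `0` at time `τ`: it is zero at `τ` and positive just after `τ`. -/
def LeavesZero (T : ℝ) (h : ℝ → ℝ) (τ : ℝ) : Prop :=
  0 ≤ τ ∧ τ < T ∧ h τ = 0 ∧ ∀ᶠ u in 𝓝[>] τ, 0 < h u

/-- Piecewise continuity on `[0, T]`: finitely many discontinuities, with one-sided limits. -/
def PiecewiseContinuous (T : ℝ) (h : ℝ → ℝ) : Prop :=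
  (∃ S : Set ℝ, S.Finite ∧ ContinuousOn h (Icc 0 T \ S)) ∧
    ∀ t ∈ Icc 0 T, (∃ l, Tendsto h (𝓝[Icc 0 T ∩ Iio t] t) (𝓝 l)) ∧
      ∃ l, Tendsto h (𝓝[Icc 0 T ∩ Ioi t] t) (𝓝 l)

/-- The observable events. `zetaPlus i j` stands only for those departures of `Z_ij` from `0`
that take place while `X_i = 0`; a departure while `X_i > 0` is induced by the motion of the
agents and is not recorded. -/
inductive Event (M N : ℕ) : Type
  | xiZero (i : Fin M)
  | xiPlus (i : Fin M)
  | zetaZero (i : Fin M) (j : Fin N)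
  | zetaPlus (i : Fin M) (j : Fin N)
  | deltaPlus (i : Fin M) (j : Fin N)
  | deltaZero (i : Fin M) (j : Fin N)
  | basePlus (j : Fin N)
  | baseZero (j : Fin N)

namespace Setting

variable {M N : ℕ} {d : Fin N → ℕ} (S : Setting M N d)

/-- Position of agent `j`. -/
def s (j : Fin N) (Θ : Params d) (t : ℝ) : Plane :=
  !₂[S.f j (Θ j) (S.ρ j (Θ j) t), S.g j (Θ j) (S.ρ j (Θ j) t)]

/-- `D_ij(t)` -/
def D (i : Fin M) (j : Fin N) (Θ : Params d) (t : ℝ) : ℝ := dist (S.w i) (S.s j Θ t)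

/-- `D_Bj(t)` -/
def DB (j : Fin N) (Θ : Params d) (t : ℝ) : ℝ := dist S.wB (S.s j Θ t)

/-- `D_ij⁺(t)` -/
def Dplus (i : Fin M) (j : Fin N) (Θ : Params d) (t : ℝ) : ℝ := max 0 (S.D i j Θ t - S.r i j)

/-- `D_Bj⁺(t)` -/
def DBplus (j : Fin N) (Θ : Params d) (t : ℝ) : ℝ := max 0 (S.DB j Θ t - S.rB j)

/-- `P_ij(t)` -/
def P (i : Fin M) (j : Fin N) (Θ : Params d) (t : ℝ) : ℝ := S.p i j (S.D i j Θ t)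

/-- `P_Bj(t)` -/
def PB (j : Fin N) (Θ : Params d) (t : ℝ) : ℝ := S.pB j (S.DB j Θ t)

/-- `μ_ij P_ij(t)` for the agent `j` connected to target `i`, and `0` if there is none. -/
def drain (i : Fin M) (Θ : Params d) (t : ℝ) : ℝ :=
  match S.conn Θ t i with
  | none => 0
  | some j => S.μ i j * S.P i j Θ t

/-- Right-hand side of the dynamics of `X_i`, for arrival rate `a` and content `x`. -/
def Xdot (i : Fin M) (Θ : Params d) (t a x : ℝ) : ℝ :=
  if x = 0 ∧ a ≤ S.drain i Θ t then 0 else a - S.drain i Θ t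

/-- The effective collection rate of agent `j` at target `i`; it vanishes if `j` is not
connected to `i`. -/
def muTilde (i : Fin M) (j : Fin N) (Θ : Params d) (t a x : ℝ) : ℝ :=
  if S.conn Θ t i = some j then
    if x = 0 ∧ 0 < S.P i j Θ t then min (a / S.P i j Θ t) (S.μ i j) else S.μ i j
  else 0

/-- `μ̃_ij P_ij - β_ij P_Bj` -/
def netFlow (i : Fin M) (j : Fin N) (Θ : Params d) (t a x : ℝ) : ℝ :=
  S.muTilde i j Θ t a x * S.P i j Θ t - S.β i j * S.PB j Θ t

/-- Right-hand side of the dynamics of `Z_ij`, for on-board content `z`. -/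
def Zdot (i : Fin M) (j : Fin N) (Θ : Params d) (t a x z : ℝ) : ℝ :=
  if z = 0 ∧ S.netFlow i j Θ t a x ≤ 0 then 0 else S.netFlow i j Θ t a x

/-- Right-hand side `β_i` of the dynamics of `Y_i`, for on-board contents `z`. -/
def Ydot (i : Fin M) (Θ : Params d) (t : ℝ) (z : Fin N → ℝ) : ℝ :=
  ∑ j, if 0 < z j then S.β i j * S.PB j Θ t else 0

/-- Standing assumptions on the known data near the parameter `Θ₀`, on the horizon `[0, T]`
and the feasible set `F`. -/
structure Admissible (T : ℝ) (F : Set (Params d)) (Θ₀ : Params d) : Prop where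
  /-- rates are non-increasing in the distance, vanish out of range, and are continuous;
  the collection rates are Lipschitz in the distance -/
  p_anti : ∀ i j, AntitoneOn (S.p i j) (Ici 0)
  p_zero : ∀ i j, ∀ x, 0 ≤ x → S.r i j < x → S.p i j x = 0
  p_lip : ∀ i j, ∃ K, LipschitzOnWith K (S.p i j) (Ici 0)
  pB_anti : ∀ j, AntitoneOn (S.pB j) (Ici 0)
  pB_zero : ∀ j, ∀ x, 0 ≤ x → S.rB j < x → S.pB j x = 0
  pB_cont : ∀ j, ContinuousOn (S.pB j) (Ici 0)
  μ_nonneg : ∀ i j, 0 ≤ S.μ i j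
  β_nonneg : ∀ i j, 0 ≤ S.β i j
  /-- an agent cannot collect and deliver at the same time -/
  separated : ∀ i j, S.r i j + S.rB j < dist (S.w i) S.wB
  /-- trajectories are continuous in time, and Lipschitz in the parameter near `Θ₀` -/
  s_cont : ∀ j, ∀ Θ ∈ F, ContinuousOn (S.s j Θ) (Icc 0 T)
  s_lip : ∀ j, ∃ K, ∃ V ∈ 𝓝 Θ₀, ∀ t ∈ Icc 0 T, LipschitzOnWith K (fun Θ => S.s j Θ t) V
  /-- only an agent within range is connected -/
  conn_range : ∀ Θ ∈ F, ∀ t ∈ Icc 0 T, ∀ i j, S.conn Θ t i = some j → S.D i j Θ t ≤ S.r i j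
  /-- a connected agent stays connected as long as it stays within range -/
  conn_persist : ∀ Θ ∈ F, ∀ t ∈ Icc 0 T, ∀ t' ∈ Icc t T, ∀ i j, S.conn Θ t i = some j →
    (∀ u ∈ Icc t t', S.D i j Θ u ≤ S.r i j) → S.conn Θ t' i = some j
  /-- the connection to target `i` switches only where an agent enters or leaves its range -/
  conn_locConst : ∀ i, ∀ t ∈ Icc 0 T,
    (∀ j, ¬ HitsZero T (S.Dplus i j Θ₀) t ∧ ¬ LeavesZero T (S.Dplus i j Θ₀) t) →
    ∀ᶠ q in 𝓝[univ ×ˢ Icc 0 T] (Θ₀, t), S.conn q.1 q.2 i = S.conn Θ₀ t i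
  x₀_nonneg : ∀ i, ∀ Θ ∈ F, 0 ≤ S.x₀ i Θ
  z₀_nonneg : ∀ i j, ∀ Θ ∈ F, 0 ≤ S.z₀ i j Θ
  y₀_nonneg : ∀ i, ∀ Θ ∈ F, 0 ≤ S.y₀ i Θ
  x₀_diff : ∀ i, DifferentiableAt ℝ (S.x₀ i) Θ₀
  z₀_diff : ∀ i j, DifferentiableAt ℝ (S.z₀ i j) Θ₀
  y₀_diff : ∀ i, DifferentiableAt ℝ (S.y₀ i) Θ₀

/-- `(x, z, y)` is the state trajectory on `[0, T]` for the parameter `Θ` and arrival rates `a`: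
continuous, non-negative, and satisfying the dynamics except at finitely many times. -/
structure IsStatePath (T : ℝ) (Θ : Params d) (a : Fin M → ℝ → ℝ)
    (x : Fin M → ℝ → ℝ) (z : Fin M → Fin N → ℝ → ℝ) (y : Fin M → ℝ → ℝ) : Prop where
  x_cont : ∀ i, ContinuousOn (x i) (Icc 0 T)
  z_cont : ∀ i j, ContinuousOn (z i j) (Icc 0 T)
  y_cont : ∀ i, ContinuousOn (y i) (Icc 0 T)
  x_nonneg : ∀ i, ∀ t ∈ Icc 0 T, 0 ≤ x i t
  z_nonneg : ∀ i j, ∀ t ∈ Icc 0 T, 0 ≤ z i j t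
  y_nonneg : ∀ i, ∀ t ∈ Icc 0 T, 0 ≤ y i t
  x_init : ∀ i, x i 0 = S.x₀ i Θ
  z_init : ∀ i j, z i j 0 = S.z₀ i j Θ
  y_init : ∀ i, y i 0 = S.y₀ i Θ
  dynamics : ∃ C : Set ℝ, C.Finite ∧ ∀ t ∈ Ioo 0 T \ C,
    (∀ i, HasDerivAt (x i) (S.Xdot i Θ t (a i t) (x i t)) t) ∧
    (∀ i j, HasDerivAt (z i j) (S.Zdot i j Θ t (a i t) (x i t) (z i j t)) t) ∧
    ∀ i, HasDerivAt (y i) (S.Ydot i Θ t fun j => z i j t) t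

/-- The set of occurrence times in `[0, T]` of each event, observed for the parameter `Θ`
along the state trajectory `(x, z)`. -/
def eventTimes (T : ℝ) (Θ : Params d) (x : Fin M → ℝ → ℝ) (z : Fin M → Fin N → ℝ → ℝ) :
    Event M N → Set ℝ
  | .xiZero i => {τ | HitsZero T (x i) τ}
  | .xiPlus i => {τ | LeavesZero T (x i) τ}
  | .zetaZero i j => {τ | HitsZero T (z i j) τ}
  | .zetaPlus i j => {τ | LeavesZero T (z i j) τ ∧ x i τ = 0}
  | .deltaPlus i j => {τ | LeavesZero T (S.Dplus i j Θ) τ}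
  | .deltaZero i j => {τ | HitsZero T (S.Dplus i j Θ) τ}
  | .basePlus j => {τ | LeavesZero T (S.DBplus j Θ) τ}
  | .baseZero j => {τ | HitsZero T (S.DBplus j Θ) τ}

/-- The requirements on one realization: `a i t` is the arrival rate, and `x i Θ t`, `z i j Θ t`,
`y i Θ t` are the queue contents at time `t` for the parameter `Θ`. -/
structure IsSamplePath (T : ℝ) (F : Set (Params d)) (Θ₀ : Params d) (a : Fin M → ℝ → ℝ)
    (x : Fin M → Params d → ℝ → ℝ) (z : Fin M → Fin N → Params d → ℝ → ℝ)
    (y : Fin M → Params d → ℝ → ℝ) : Prop where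
  arrival_nonneg : ∀ i, ∀ t ∈ Icc 0 T, 0 ≤ a i t
  arrival_piecewise : ∀ i, PiecewiseContinuous T (a i)
  state : ∀ Θ ∈ F, S.IsStatePath T Θ a (fun i => x i Θ) (fun i j => z i j Θ) (fun i => y i Θ)
  /-- finitely many events occur for the observed parameter `Θ₀` -/
  finite : ∀ e, (S.eventTimes T Θ₀ (fun i => x i Θ₀) (fun i j => z i j Θ₀) e).Finite
  /-- no two events occur at the same time; the departures `zetaPlus`, which are always caused
  by other changes, are exempt -/
  simple : ∀ e e', (∀ i j, e ≠ .zetaPlus i j) → (∀ i j, e' ≠ .zetaPlus i j) → ∀ τ,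
    τ ∈ S.eventTimes T Θ₀ (fun i => x i Θ₀) (fun i j => z i j Θ₀) e →
    τ ∈ S.eventTimes T Θ₀ (fun i => x i Θ₀) (fun i j => z i j Θ₀) e' → e = e'
  /-- the derivatives of `X` and `Z` with respect to the parameter exist between events -/
  diff : ∀ t ∈ Icc 0 T,
    (∀ e, t ∉ S.eventTimes T Θ₀ (fun i => x i Θ₀) (fun i j => z i j Θ₀) e) →
    (∀ i, DifferentiableAt ℝ (fun Θ => x i Θ t) Θ₀) ∧
    ∀ i j, DifferentiableAt ℝ (fun Θ => z i j Θ t) Θ₀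

end Setting

end DataHarvesting

end

/-
Two realizations with the same event record have equal derivatives `X_i'` and `Z_ij'`: their
difference vanishes at time `0`, and its vanishing is carried past every time `τ`. Away from the
events, either the content is `0` under `Θ₀`, hence minimal in `Θ`, so that its derivative is `0`;
or the rates of the two contents differ by a quantity that does not depend on `Θ`, so that the
difference of the derivatives is constant; while `X_i = 0`, this is argued for `X_i + Z_ij` in place
of `Z_ij`. At an event that may upset this, no derivative jumps: the increment of the content from
`u ≤ τ` to `v > τ` exceeds its value at `Θ₀` by at most `O((v - u) ‖Θ - Θ₀‖)`, and a one-sided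
bound of this kind suffices to bound the norm of its derivative, which is linear. Finally
`X_i + ∑_j Z_ij + Y_i` grows by what arrives at the target whatever `Θ` is, and this determines
`Y_i'`.
-/

namespace DataHarvesting

theorem forall_Icc_of_propagates {a b : ℝ} {P : ℝ → Prop}
    (h : ∀ τ ∈ Icc a b, (∀ u ∈ Ico a τ, P u) → ∀ᶠ u in 𝓝[Icc τ b] τ, P u) :
    ∀ t ∈ Icc a b, P t := by
  intro t ht
  set K := lowerBounds {u ∈ Icc a b | ¬ P u} with hK
  have hclosed : IsClosed K := by
    rw [hK, show lowerBounds _ = ⋂ u ∈ {u ∈ Icc a b | ¬ P u}, Iic u by ext; simp [lowerBounds]]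
    exact isClosed_biInter fun _ _ => isClosed_Iic
  have hbefore : ∀ τ ∈ K, τ ≤ b → ∀ u ∈ Ico a τ, P u := fun τ hτ hτb u hu => by
    by_contra hP
    exact (hτ ⟨⟨hu.1, hu.2.le.trans hτb⟩, hP⟩).not_gt hu.2
  have hsub : Icc a b ⊆ K := by
    refine (hclosed.inter isClosed_Icc).Icc_subset_of_forall_mem_nhdsWithin
      (fun u hu => hu.1.1) fun τ hτ => ?_
    have hnear := h τ (Ico_subset_Icc_self hτ.2) (hbefore τ hτ.1 hτ.2.2.le)
    rw [nhdsWithin_Icc_eq_nhdsGE hτ.2.2] at hnear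
    obtain ⟨c, hc, hcP⟩ := mem_nhdsGE_iff_exists_Ico_subset.1 hnear
    filter_upwards [Ioo_mem_nhdsGT hc] with s hs u hu
    by_contra! hus
    exact hu.2 (hcP ⟨hτ.1 hu, hus.trans hs.2⟩)
  exact (h t ht (hbefore t (hsub ht) ht.2)).self_of_nhdsWithin (left_mem_Icc.2 ht.2)

theorem exists_isLast_nonpos {f : ℝ → ℝ} {a b : ℝ} (hf : ContinuousOn f (Icc a b))
    (hb : 0 < f b) (h : ∃ s ∈ Icc a b, f s ≤ 0) :
    ∃ s ∈ Ico a b, f s ≤ 0 ∧ ∀ u ∈ Ioc s b, 0 < f u := by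
  have hK : IsCompact {s ∈ Icc a b | f s ≤ 0} :=
    isCompact_Icc.of_isClosed_subset (hf.preimage_isClosed_of_isClosed isClosed_Icc isClosed_Iic)
      fun s hs => hs.1
  obtain ⟨s, ⟨hs, hs0⟩, hmax⟩ := hK.exists_isGreatest h
  refine ⟨s, ⟨hs.1, hs.2.lt_of_ne (by rintro rfl; exact hs0.not_gt hb)⟩, hs0, fun u hu => ?_⟩
  by_contra! hu0
  exact (hmax ⟨⟨hs.1.trans hu.1.le, hu.2⟩, hu0⟩).not_gt hu.1

theorem exists_isFirst_nonpos {f : ℝ → ℝ} {a b : ℝ} (hf : ContinuousOn f (Icc a b))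
    (ha : 0 < f a) (h : ∃ s ∈ Icc a b, f s ≤ 0) :
    ∃ s ∈ Ioc a b, f s ≤ 0 ∧ ∀ u ∈ Ico a s, 0 < f u := by
  have hK : IsCompact {s ∈ Icc a b | f s ≤ 0} :=
    isCompact_Icc.of_isClosed_subset (hf.preimage_isClosed_of_isClosed isClosed_Icc isClosed_Iic)
      fun s hs => hs.1
  obtain ⟨s, ⟨hs, hs0⟩, hmin⟩ := hK.exists_isLeast h
  refine ⟨s, ⟨hs.1.lt_of_ne (by rintro rfl; exact hs0.not_gt ha), hs.2⟩, hs0, fun u hu => ?_⟩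
  by_contra! hu0
  exact (hmin ⟨⟨hu.1, hu.2.le.trans hs.2⟩, hu0⟩).not_gt hu.2

theorem eventually_notMem_nhdsNE {B : Set ℝ} (hB : B.Finite) (τ : ℝ) : ∀ᶠ u in 𝓝[≠] τ, u ∉ B := by
  have h : ∀ᶠ u in 𝓝 τ, u ∉ B \ {τ} := hB.sdiff.isClosed.isOpen_compl.mem_nhds (by simp)
  filter_upwards [nhdsWithin_le_nhds h, self_mem_nhdsWithin] with u hu hne hB
  exact hu ⟨hB, hne⟩

theorem eventually_notMem_nhdsGT {B : Set ℝ} (hB : B.Finite) (τ : ℝ) : ∀ᶠ u in 𝓝[>] τ, u ∉ B :=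
  (eventually_notMem_nhdsNE hB τ).filter_mono (nhdsWithin_mono _ fun _ h => ne_of_gt h)

theorem eventually_notMem_nhdsLT {B : Set ℝ} (hB : B.Finite) (τ : ℝ) : ∀ᶠ u in 𝓝[<] τ, u ∉ B :=
  (eventually_notMem_nhdsNE hB τ).filter_mono (nhdsWithin_mono _ fun _ h => ne_of_lt h)

theorem Icc_mem_nhdsGT_of_mem_Ico {T τ : ℝ} (hτ : τ ∈ Ico 0 T) : Icc 0 T ∈ 𝓝[>] τ :=
  mem_of_superset (Ioo_mem_nhdsGT hτ.2) fun _ hs => ⟨hτ.1.trans hs.1.le, hs.2.le⟩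

theorem Icc_mem_nhdsLT_of_mem_Ioc {T τ : ℝ} (hτ : τ ∈ Ioc 0 T) : Icc 0 T ∈ 𝓝[<] τ :=
  mem_of_superset (Ioo_mem_nhdsLT hτ.1) fun _ hs => ⟨hs.1.le, hs.2.le.trans hτ.2⟩

theorem eventually_nhdsWithin_Icc_iff {p : ℝ → Prop} {T τ : ℝ} (hτ : τ ∈ Icc 0 T) :
    (∀ᶠ u in 𝓝[Icc 0 T] τ, p u) ↔
      p τ ∧ (0 < τ → ∀ᶠ u in 𝓝[<] τ, p u) ∧ (τ < T → ∀ᶠ u in 𝓝[>] τ, p u) := by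
  refine ⟨fun h => ⟨h.self_of_nhdsWithin hτ,
    fun h0 => h.filter_mono (nhdsWithin_le_iff.2 (Icc_mem_nhdsLT_of_mem_Ioc ⟨h0, hτ.2⟩)),
    fun hT => h.filter_mono (nhdsWithin_le_iff.2 (Icc_mem_nhdsGT_of_mem_Ico ⟨hτ.1, hT⟩))⟩, ?_⟩
  rintro ⟨hp, hl, hr⟩
  rw [← Icc_union_Icc_eq_Icc hτ.1 hτ.2, nhdsWithin_union, eventually_sup]
  constructor
  · rcases hτ.1.eq_or_lt with rfl | h0
    · simpa using hp
    · rw [nhdsWithin_Icc_eq_nhdsLE h0, ← Iio_insert, nhdsWithin_insert, eventually_sup]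
      exact ⟨hp, hl h0⟩
  · rcases hτ.2.eq_or_lt with rfl | hT
    · simpa using hp
    · rw [nhdsWithin_Icc_eq_nhdsGE hT, ← Ioi_insert, nhdsWithin_insert, eventually_sup]
      exact ⟨hp, hr hT⟩

theorem eventuallyConst_of_eventually_prod {α β : Type*} {f : α → β} {l : Filter α}
    (h : ∀ᶠ q in l ×ˢ l, f q.1 = f q.2) : EventuallyConst f l := by
  rcases l.eq_or_neBot with rfl | _
  · exact .bot
  obtain ⟨u, hu⟩ := h.curry.exists
  exact (EventuallyConst.const (f u)).congr hu

theorem sub_le_mul_sub_of_hasDerivAt_off_finite {C : Set ℝ} (hC : C.Finite) {f : ℝ → ℝ}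
    {a b c : ℝ} (hab : a ≤ b) (hf : ContinuousOn f (Icc a b))
    (h : ∀ s ∈ Ioo a b, s ∉ C → ∃ f', HasDerivAt f f' s ∧ f' ≤ c) : f b - f a ≤ c * (b - a) := by
  induction C, hC using Set.Finite.induction_on generalizing a b with
  | empty =>
    choose! f' hf' hle using fun s hs => h s hs (notMem_empty s)
    refine (convex_Icc a b).image_sub_le_mul_sub_of_deriv_le hf ?_ ?_ a (left_mem_Icc.2 hab) b
      (right_mem_Icc.2 hab) hab <;> rw [interior_Icc]
    · exact fun s hs => (hf' s hs).differentiableAt.differentiableWithinAt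
    · exact fun s hs => (hf' s hs).deriv.trans_le (hle s hs)
  | @insert p C _ _ ih =>
    by_cases hp : p ∈ Ioo a b
    · have hleft : f p - f a ≤ c * (p - a) := ih hp.1.le (hf.mono (Icc_subset_Icc_right hp.2.le))
        fun s hs hsC => h s ⟨hs.1, hs.2.trans hp.2⟩ (by simp [hs.2.ne, hsC])
      have hright : f b - f p ≤ c * (b - p) := ih hp.2.le (hf.mono (Icc_subset_Icc_left hp.1.le))
        fun s hs hsC => h s ⟨hp.1.trans hs.1, hs.2⟩ (by simp [hs.1.ne', hsC])
      linarith
    · exact ih hab hf fun s hs hsC =>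
        h s hs (by simp [ne_of_mem_of_not_mem hs hp, hsC])

/-! ### Primitives and propagation of vanishing -/

/-- `f` is a primitive of `f'` on `[0, T]` in the sense of the queue dynamics: it is continuous
and its derivative is `f'` at all but finitely many times. -/
structure IsPrimitive (T : ℝ) (f f' : ℝ → ℝ) : Prop where
  continuousOn : ContinuousOn f (Icc 0 T)
  hasDerivAt : ∀ᶠ s in cofinite, s ∈ Ioo 0 T → HasDerivAt f (f' s) s

namespace IsPrimitive

variable {T : ℝ} {f g f' g' : ℝ → ℝ}

theorem add (hf : IsPrimitive T f f') (hg : IsPrimitive T g g') :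
    IsPrimitive T (fun t => f t + g t) fun t => f' t + g' t :=
  ⟨hf.continuousOn.add hg.continuousOn, by
    filter_upwards [hf.hasDerivAt, hg.hasDerivAt] with s h₁ h₂ hs using (h₁ hs).add (h₂ hs)⟩

theorem sub (hf : IsPrimitive T f f') (hg : IsPrimitive T g g') :
    IsPrimitive T (fun t => f t - g t) fun t => f' t - g' t :=
  ⟨hf.continuousOn.sub hg.continuousOn, by
    filter_upwards [hf.hasDerivAt, hg.hasDerivAt] with s h₁ h₂ hs using (h₁ hs).sub (h₂ hs)⟩

theorem neg (hf : IsPrimitive T f f') : IsPrimitive T (fun t => -f t) fun t => -f' t :=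
  ⟨hf.continuousOn.neg, by
    filter_upwards [hf.hasDerivAt] with s h hs using (h hs).neg⟩

theorem sum {ι : Type*} {A : Finset ι} {f f' : ι → ℝ → ℝ}
    (h : ∀ i ∈ A, IsPrimitive T (f i) (f' i)) :
    IsPrimitive T (fun t => ∑ i ∈ A, f i t) fun t => ∑ i ∈ A, f' i t :=
  ⟨continuousOn_finsetSum _ fun i hi => (h i hi).continuousOn, by
    filter_upwards [(Finset.eventually_all A).2 fun i hi => (h i hi).hasDerivAt] with s hs hsI
      using HasDerivAt.fun_sum fun i hi => hs i hi hsI⟩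

theorem sub_le_mul_sub (hf : IsPrimitive T f f') {a b c : ℝ} (ha : 0 ≤ a) (hab : a ≤ b)
    (hb : b ≤ T) (h : ∀ s ∈ Ioo a b, f' s ≤ c) : f b - f a ≤ c * (b - a) :=
  sub_le_mul_sub_of_hasDerivAt_off_finite hf.hasDerivAt hab
    (hf.continuousOn.mono (Icc_subset_Icc ha hb))
    fun s hs hsC => ⟨_, not_not.1 hsC ⟨ha.trans_lt hs.1, hs.2.trans_le hb⟩, h s hs⟩

theorem sub_eq_sub (hf : IsPrimitive T f f') (hg : IsPrimitive T g g') {a b : ℝ} (ha : 0 ≤ a)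
    (hab : a ≤ b) (hb : b ≤ T) (h : ∀ s ∈ Ioo a b, f' s = g' s) : f b - f a = g b - g a := by
  have h₁ := (hf.sub hg).sub_le_mul_sub (c := 0) ha hab hb fun s hs => by simp [h s hs]
  have h₂ := (hg.sub hf).sub_le_mul_sub (c := 0) ha hab hb fun s hs => by simp [h s hs]
  linarith

theorem le_max_add_mul_sub (hf : IsPrimitive T f f') {a b c : ℝ} (hc : 0 ≤ c) (ha : 0 ≤ a)
    (hab : a ≤ b) (hb : b ≤ T) (h : ∀ s ∈ Ioo a b, 0 < f s → f' s ≤ c) :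
    f b ≤ max (f a) 0 + c * (b - a) := by
  rcases le_or_gt (f b) 0 with hfb | hfb
  · exact hfb.trans (add_nonneg (le_max_right _ _) (mul_nonneg hc (sub_nonneg.2 hab)))
  by_cases hz : ∃ s ∈ Icc a b, f s ≤ 0
  · obtain ⟨s, hs, hs0, hpos⟩ :=
      exists_isLast_nonpos (hf.continuousOn.mono (Icc_subset_Icc ha hb)) hfb hz
    have hsb := hf.sub_le_mul_sub (c := c) (ha.trans hs.1) hs.2.le hb fun t ht =>
      h t ⟨hs.1.trans_lt ht.1, ht.2⟩ (hpos t (Ioo_subset_Ioc_self ht))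
    have hsa : c * (b - s) ≤ c * (b - a) := by gcongr; exact hs.1
    linarith [le_max_right (f a) 0]
  · push Not at hz
    have hab' := hf.sub_le_mul_sub (c := c) ha hab hb fun t ht =>
      h t ht (hz t (Ioo_subset_Icc_self ht))
    linarith [le_max_left (f a) 0]

end IsPrimitive

section RegularTimes

/-- The times in `[0, T]` at which a state derivative is defined: those outside the set `B` of
event times, and the initial time, where the state is prescribed even if an event occurs. -/
def regularTimes (T : ℝ) (B : Set ℝ) : Set ℝ := {t ∈ Icc 0 T | t = 0 ∨ t ∉ B}

/-- Pairs of regular times `(u, v)` with `u ≤ τ < v`, as both tend to `τ`. -/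
abbrev across (T : ℝ) (B : Set ℝ) (τ : ℝ) : Filter (ℝ × ℝ) :=
  𝓝[regularTimes T B ∩ Iic τ] τ ×ˢ 𝓝[regularTimes T B ∩ Ioi τ] τ

/-- `Δ` has no jump at `τ`. Only the increments of `Δ` across `τ` are required to vanish in the
limit: neither a value at `τ` nor one-sided limits need to exist. -/
def HasNoJump {V : Type*} [NormedAddCommGroup V] (T : ℝ) (B : Set ℝ) (Δ : ℝ → V) (τ : ℝ) : Prop :=
  Tendsto (fun q : ℝ × ℝ => Δ q.2 - Δ q.1) (across T B τ) (𝓝 0)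

/-- The ways in which the vanishing of a state derivative `Δ` before `τ` is carried past `τ`: it is
constant around `τ`, or `τ` is an event time after which `Δ` is zero or at which it does not
jump. -/
def VanishingPropagates {V : Type*} [NormedAddCommGroup V] (T : ℝ) (B : Set ℝ) (Δ : ℝ → V)
    (τ : ℝ) : Prop :=
  EventuallyConst Δ (𝓝[regularTimes T B] τ) ∨
    τ ∈ B ∧ ((∀ᶠ v in 𝓝[regularTimes T B ∩ Ioi τ] τ, Δ v = 0) ∨ HasNoJump T B Δ τ)

variable {T τ : ℝ} {B : Set ℝ}

theorem regularTimes_subset_Icc : regularTimes T B ⊆ Icc 0 T := fun _ ht => ht.1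

theorem zero_mem_regularTimes (hT : 0 ≤ T) : 0 ∈ regularTimes T B := ⟨left_mem_Icc.2 hT, .inl rfl⟩

theorem regularTimes_mem_nhds (hB : B.Finite) (hτ : τ ∈ Ioo 0 T) (hτB : τ ∉ B) :
    regularTimes T B ∈ 𝓝 τ := by
  filter_upwards [Icc_mem_nhds hτ.1 hτ.2, hB.isClosed.isOpen_compl.mem_nhds hτB] with s hs hsB
    using ⟨hs, .inr hsB⟩

theorem exists_mem_regularTimes_left (hB : B.Finite) (hτ : τ ∈ Icc 0 T) {p : ℝ → Prop}
    (hp : ∀ᶠ u in 𝓝[Icc 0 T] τ, p u) :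
    ∃ u ∈ regularTimes T B, (u < τ ∨ u = τ ∧ τ = 0) ∧ p u := by
  obtain ⟨hpτ, hpl, -⟩ := (eventually_nhdsWithin_Icc_iff hτ).1 hp
  rcases hτ.1.eq_or_lt with rfl | h0
  · exact ⟨0, zero_mem_regularTimes hτ.2, .inr ⟨rfl, rfl⟩, hpτ⟩
  obtain ⟨u, hu, huB, hu0⟩ :=
    ((hpl h0).and ((eventually_notMem_nhdsLT hB τ).and (Ioo_mem_nhdsLT h0))).exists
  exact ⟨u, ⟨⟨hu0.1.le, hu0.2.le.trans hτ.2⟩, .inr huB⟩, .inl hu0.2, hu⟩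

theorem neBot_nhdsWithin_regularTimes_Iic (hB : B.Finite) (hτ : τ ∈ Icc 0 T) :
    (𝓝[regularTimes T B ∩ Iic τ] τ).NeBot := by
  refine neBot_iff.2 fun hbot => ?_
  have hnot : ∀ᶠ u in 𝓝[Icc 0 T] τ, ¬ (u ∈ regularTimes T B ∧ u ≤ τ) :=
    nhdsWithin_le_nhds ((mem_nhdsWithin_iff_eventually.1 (hbot ▸ mem_bot : (∅ : Set ℝ) ∈ _)).mono
      fun u hu => hu)
  obtain ⟨u, hu, hlt, hnot⟩ := exists_mem_regularTimes_left hB hτ hnot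
  exact hnot ⟨hu, hlt.elim le_of_lt fun h => h.1.le⟩

theorem across_le : across T B τ ≤ 𝓝[Icc 0 T] τ ×ˢ 𝓝[Icc 0 T] τ :=
  prod_mono (nhdsWithin_mono _ (inter_subset_left.trans regularTimes_subset_Icc))
    (nhdsWithin_mono _ (inter_subset_left.trans regularTimes_subset_Icc))

theorem eventually_mem_across : ∀ᶠ q in across T B τ,
    q.1 ∈ regularTimes T B ∩ Iic τ ∧ q.2 ∈ regularTimes T B ∩ Ioi τ :=
  eventually_mem_nhdsWithin.prod_mk eventually_mem_nhdsWithin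

theorem eventually_forall_Icc {p : ℝ → Prop} (h : ∀ᶠ s in 𝓝[Icc 0 T] τ, p s) :
    ∀ᶠ q in 𝓝[Icc 0 T] τ ×ˢ 𝓝[Icc 0 T] τ, ∀ s ∈ Icc q.1 q.2, p s := by
  have := (tendsto_fst (f := 𝓝[Icc 0 T] τ) (g := 𝓝[Icc 0 T] τ)).Icc tendsto_snd
  exact this.eventually h.smallSets

theorem eventually_forall_Icc_of_eventually_prod {E : Type*} [TopologicalSpace E]
    {Θ₀ : E} {R : E → ℝ → Prop} (h : ∀ᶠ q in 𝓝 Θ₀ ×ˢ 𝓝[Icc 0 T] τ, R q.1 q.2) :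
    ∀ᶠ q in 𝓝[Icc 0 T] τ ×ˢ 𝓝[Icc 0 T] τ, ∀ᶠ Θ in 𝓝 Θ₀, ∀ s ∈ Icc q.1 q.2, R Θ s := by
  obtain ⟨p, hp, p', hp', hR⟩ := eventually_prod_iff.1 h
  filter_upwards [eventually_forall_Icc hp'] with q hq
  filter_upwards [hp] with Θ hΘ s hs using hR hΘ (hq s hs)

theorem eventually_of_eventually_prod {E : Type*} [TopologicalSpace E] {Θ₀ : E}
    {R : E → ℝ → Prop} {l : Filter ℝ} (h : ∀ᶠ q in 𝓝 Θ₀ ×ˢ l, R q.1 q.2) :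
    ∀ᶠ s in l, R Θ₀ s := by
  obtain ⟨p, hp, p', hp', hR⟩ := eventually_prod_iff.1 h
  exact hp'.mono fun s hs => hR hp.self_of_nhds hs

theorem eventuallyConst_principal_of_isPreconnected {α : Type*} {f : ℝ → α} {s : Set ℝ}
    (hs : IsPreconnected s) (h : ∀ t ∈ s, EventuallyConst f (𝓝 t)) : EventuallyConst f (𝓟 s) := by
  refine eventuallyConst_of_eventually_prod ?_
  rw [prod_principal_principal, eventually_principal]
  rintro ⟨u, v⟩ ⟨hu, hv⟩
  refine hs.induction₂ (fun u v => f u = f v) (fun u hu => ?_)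
    (fun _ _ _ _ _ _ => Eq.trans) (fun _ _ _ _ => Eq.symm) hu hv
  have : Nonempty α := ⟨f u⟩
  obtain ⟨c, hc⟩ := eventuallyConst_iff_exists_eventuallyEq.1 (h u hu)
  filter_upwards [nhdsWithin_le_nhds hc] with v hv using hc.self_of_nhds.trans hv.symm

theorem eventuallyConst_nhdsLT_and_nhdsGT {α : Type*} {f : ℝ → α} (hB : B.Finite)
    (h : ∀ t ∈ Ioo 0 T, t ∉ B → EventuallyConst f (𝓝 t)) (hτ : τ ∈ Icc 0 T) :
    EventuallyConst f (𝓝[Ico 0 τ] τ) ∧ EventuallyConst f (𝓝[Ioc τ T] τ) := by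
  constructor
  · rcases hτ.1.eq_or_lt with rfl | h0
    · simp
    rw [nhdsWithin_Ico_eq_nhdsLT h0]
    obtain ⟨b, hb, hbB⟩ := (mem_nhdsLT_iff_exists_Ioo_subset' h0).1
      ((eventually_notMem_nhdsLT hB τ).and (Ioo_mem_nhdsLT h0))
    exact (eventuallyConst_principal_of_isPreconnected isPreconnected_Ioo fun t ht =>
      h t ⟨(hbB ht).2.1, ht.2.trans_le hτ.2⟩ (hbB ht).1).anti
        (le_principal_iff.2 (Ioo_mem_nhdsLT hb))
  · rcases hτ.2.eq_or_lt with rfl | hT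
    · simp
    rw [nhdsWithin_Ioc_eq_nhdsGT hT]
    obtain ⟨b, hb, hbB⟩ := (mem_nhdsGT_iff_exists_Ioo_subset' hT).1
      ((eventually_notMem_nhdsGT hB τ).and (Ioo_mem_nhdsGT hT))
    exact (eventuallyConst_principal_of_isPreconnected isPreconnected_Ioo fun t ht =>
      h t ⟨hτ.1.trans_lt ht.1, (hbB ht).2.2⟩ (hbB ht).1).anti
        (le_principal_iff.2 (Ioo_mem_nhdsGT hb))

section Jumps

variable {V : Type*} [NormedAddCommGroup V] {Δ Δ' : ℝ → V}

theorem HasNoJump.sub (h : HasNoJump T B Δ τ) (h' : HasNoJump T B Δ' τ) :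
    HasNoJump T B (fun t => Δ t - Δ' t) τ := by
  have := Tendsto.sub h h'
  rw [sub_zero] at this
  exact this.congr fun q => sub_sub_sub_comm _ _ _ _

theorem HasNoJump.sum {ι : Type*} {A : Finset ι} {Δ : ι → ℝ → V}
    (h : ∀ i ∈ A, HasNoJump T B (Δ i) τ) : HasNoJump T B (fun t => ∑ i ∈ A, Δ i t) τ := by
  have := tendsto_finsetSum A h
  rw [Finset.sum_const_zero] at this
  exact this.congr fun q => Finset.sum_sub_distrib _ _

theorem hasNoJump_of_eventually_eq (h : ∀ᶠ q in across T B τ, Δ q.1 = Δ q.2) :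
    HasNoJump T B Δ τ :=
  tendsto_const_nhds.congr' (h.mono fun _ hq => (sub_eq_zero.2 hq.symm).symm)

theorem hasNoJump_of_eventuallyConst (h : EventuallyConst Δ (𝓝[regularTimes T B] τ)) :
    HasNoJump T B Δ τ := by
  have : Nonempty V := ⟨0⟩
  obtain ⟨c, hc⟩ := eventuallyConst_iff_exists_eventuallyEq.1 h
  have hc₁ := hc.filter_mono (nhdsWithin_mono τ (inter_subset_left (t := Iic τ)))
  have hc₂ := hc.filter_mono (nhdsWithin_mono τ (inter_subset_left (t := Ioi τ)))
  exact hasNoJump_of_eventually_eq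
    ((hc₁.prod_mk hc₂).mono fun q hq => hq.1.trans hq.2.symm)

theorem eventually_eq_zero_of_hasNoJump (hB : B.Finite) (hτ : τ ∈ Icc 0 T)
    (hleft : ∀ u ∈ regularTimes T B, u ≤ τ → Δ u = 0) (hjump : HasNoJump T B Δ τ)
    (hconst : EventuallyConst Δ (𝓝[Ioc τ T] τ)) :
    ∀ᶠ v in 𝓝[regularTimes T B ∩ Ioi τ] τ, Δ v = 0 := by
  rcases (𝓝[regularTimes T B ∩ Ioi τ] τ).eq_or_neBot with hbot | _
  · simp only [hbot, eventually_bot]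
  have := neBot_nhdsWithin_regularTimes_Iic hB hτ
  obtain ⟨c, hc⟩ := eventuallyConst_iff_exists_eventuallyEq.1 (hconst.anti
    (nhdsWithin_mono τ fun v (hv : v ∈ regularTimes T B ∩ Ioi τ) => ⟨hv.2, hv.1.1.2⟩))
  have hc0 : c = 0 := by
    refine tendsto_nhds_unique_of_eventuallyEq tendsto_const_nhds hjump ?_
    filter_upwards [eventually_mem_across, tendsto_snd.eventually hc] with q hq hqc
    rw [hleft q.1 hq.1.1 hq.1.2, hqc, sub_zero]
  exact hc0 ▸ hc

theorem eq_zero_of_vanishingPropagates (hB : B.Finite) (h0 : Δ 0 = 0)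
    (h : ∀ τ ∈ Icc 0 T, VanishingPropagates T B Δ τ) : ∀ t ∈ regularTimes T B, Δ t = 0 := by
  suffices ∀ t ∈ Icc 0 T, t ∈ regularTimes T B → Δ t = 0 from fun t ht => this t ht.1 ht
  refine forall_Icc_of_propagates fun τ hτ hbefore => ?_
  have hloc : ∀ s ∈ Ioo 0 T, s ∉ B → EventuallyConst Δ (𝓝 s) := fun s hs hsB => by
    rw [← nhdsWithin_eq_nhds.2 (regularTimes_mem_nhds hB hs hsB)]
    exact (h s (Ioo_subset_Icc_self hs)).resolve_right fun h' => hsB h'.1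
  have hbefore' : ∀ u ∈ regularTimes T B, (u < τ ∨ u = τ ∧ τ = 0) → Δ u = 0 := by
    rintro u hu (hlt | ⟨rfl, rfl⟩)
    exacts [hbefore u ⟨hu.1.1, hlt⟩ hu, h0]
  rcases h τ hτ with hconst | ⟨hτB, hright⟩
  · obtain ⟨c, hc⟩ := eventuallyConst_iff_exists_eventuallyEq.1 hconst
    have hc' := eventually_nhdsWithin_iff.1 hc
    obtain ⟨u, hu, hlt, huc⟩ := exists_mem_regularTimes_left hB hτ (nhdsWithin_le_nhds hc')
    filter_upwards [nhdsWithin_le_nhds hc'] with v hv hvR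
    exact ((hv hvR).trans (huc hu).symm).trans (hbefore' u hu hlt)
  · have hleft : ∀ u ∈ regularTimes T B, u ≤ τ → Δ u = 0 := fun u hu hle => by
      rcases hle.lt_or_eq with hlt | rfl
      · exact hbefore' u hu (.inl hlt)
      · exact hbefore' u hu (.inr ⟨rfl, hu.2.resolve_right (not_not.2 hτB)⟩)
    have hright' := hright.elim id fun hjump => eventually_eq_zero_of_hasNoJump hB hτ hleft hjump
      (eventuallyConst_nhdsLT_and_nhdsGT hB hloc hτ).2
    filter_upwards [nhdsWithin_le_nhds (eventually_nhdsWithin_iff.1 hright'),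
      self_mem_nhdsWithin] with v hv hvτ hvR
    exact hvτ.1.lt_or_eq.elim (fun hlt => hv ⟨hvR, hlt⟩) fun heq => hleft v hvR heq.ge

theorem vanishingPropagates_sub_of_eventually_eq_zero
    (h : (∀ᶠ u in 𝓝[Icc 0 T] τ, Δ u = 0) ∨ τ ∈ B ∧ ∀ᶠ u in 𝓝[Ioc τ T] τ, Δ u = 0)
    (h' : (∀ᶠ u in 𝓝[Icc 0 T] τ, Δ' u = 0) ∨ τ ∈ B ∧ ∀ᶠ u in 𝓝[Ioc τ T] τ, Δ' u = 0) :
    VanishingPropagates T B (fun t => Δ t - Δ' t) τ := by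
  have hIcc : regularTimes T B ∩ Ioi τ ⊆ Icc 0 T := fun v hv => hv.1.1
  have hIoc : regularTimes T B ∩ Ioi τ ⊆ Ioc τ T := fun v hv => ⟨hv.2, hv.1.1.2⟩
  by_cases hτB : τ ∈ B
  · have right : ∀ {Γ : ℝ → V}, ((∀ᶠ u in 𝓝[Icc 0 T] τ, Γ u = 0) ∨
        τ ∈ B ∧ ∀ᶠ u in 𝓝[Ioc τ T] τ, Γ u = 0) →
        ∀ᶠ v in 𝓝[regularTimes T B ∩ Ioi τ] τ, Γ v = 0 := fun hΓ =>
      hΓ.elim (·.filter_mono (nhdsWithin_mono τ hIcc)) (·.2.filter_mono (nhdsWithin_mono τ hIoc))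
    refine .inr ⟨hτB, .inl ?_⟩
    filter_upwards [right h, right h'] with v hv hv'
    rw [hv, hv', sub_zero]
  · have : Nonempty V := ⟨0⟩
    refine .inl (EventuallyConst.anti (eventuallyConst_iff_exists_eventuallyEq.2 ⟨0, ?_⟩)
      (nhdsWithin_mono τ regularTimes_subset_Icc))
    filter_upwards [h.resolve_right fun h => hτB h.1, h'.resolve_right fun h => hτB h.1]
      with u hu hu'
    rw [hu, hu', sub_zero]

end Jumps

end RegularTimes

/-! ### Derivatives with respect to the parameter -/

theorem eventually_pos_of_neg_le {E : Type*} [TopologicalSpace E] {T τ : ℝ} {B : Set ℝ} {Θ₀ : E}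
    {φ φ' : E → ℝ → ℝ} {L : ℝ} (hB : B.Finite)
    (hφ : ∀ᶠ Θ in 𝓝 Θ₀, IsPrimitive T (φ Θ) (φ' Θ))
    (hcont : ∀ u ∈ regularTimes T B, ContinuousAt (fun Θ => φ Θ u) Θ₀)
    (hL : ∀ᶠ Θ in 𝓝 Θ₀, ∀ s ∈ Icc 0 T, -L ≤ φ' Θ s) (hτ : τ ∈ Icc 0 T) (hpos : 0 < φ Θ₀ τ) :
    ∀ᶠ q in 𝓝 Θ₀ ×ˢ 𝓝[Icc 0 T] τ, 0 < φ q.1 q.2 := by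
  have hlim : Tendsto (fun u => φ Θ₀ u - L * (τ - u)) (𝓝[Icc 0 T] τ) (𝓝 (φ Θ₀ τ)) := by
    have hlin : Continuous fun u => L * (τ - u) := by fun_prop
    simpa only [sub_self, mul_zero, sub_zero] using
      (hφ.self_of_nhds.continuousOn τ hτ).tendsto.sub
        ((hlin.tendsto τ).mono_left nhdsWithin_le_nhds)
  obtain ⟨u, hu, hlt, hupos⟩ := exists_mem_regularTimes_left hB hτ (hlim.eventually_const_lt hpos)
  have hright : ∀ᶠ s in 𝓝[Icc 0 T] τ, u ≤ s := by
    rcases hlt with hlt | ⟨rfl, rfl⟩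
    · exact nhdsWithin_le_nhds (Ici_mem_nhds hlt)
    · exact eventually_mem_nhdsWithin.mono fun s hs => hs.1
  have hcont' : Tendsto (fun q : E × ℝ => φ q.1 u - L * (q.2 - u)) (𝓝 Θ₀ ×ˢ 𝓝[Icc 0 T] τ)
      (𝓝 (φ Θ₀ u - L * (τ - u))) :=
    ((hcont u hu).tendsto.comp tendsto_fst).sub
      (((tendsto_snd.mono_right nhdsWithin_le_nhds).sub_const u).const_mul L)
  filter_upwards [hcont'.eventually_const_lt hupos, (hφ.and hL).prod_mk
    (hright.and eventually_mem_nhdsWithin)] with q hq ⟨⟨hprim, hLq⟩, hus, hsT⟩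
  have := hprim.neg.sub_le_mul_sub (c := L) hu.1.1 hus hsT.2 fun s hs =>
    neg_le.1 (hLq s ⟨hu.1.1.trans hs.1.le, hs.2.le.trans hsT.2⟩)
  linarith

section ParamDeriv

variable {E : Type*} [NormedAddCommGroup E] [NormedSpace ℝ E] {T τ : ℝ} {B : Set ℝ} {Θ₀ : E}

/-- The derivative `φ'(t)` of a quantity `φ` with respect to the parameter, at `Θ₀`. -/
noncomputable def paramDeriv (φ : E → ℝ → ℝ) (Θ₀ : E) (t : ℝ) : E →L[ℝ] ℝ :=
  fderiv ℝ (fun Θ => φ Θ t) Θ₀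

theorem paramDeriv_eq_zero {φ : E → ℝ → ℝ} {t : ℝ} (hn : ∀ᶠ Θ in 𝓝 Θ₀, 0 ≤ φ Θ t)
    (h0 : φ Θ₀ t = 0) : paramDeriv φ Θ₀ t = 0 :=
  IsLocalMin.fderiv_eq_zero (hn.mono fun _ h => h0.trans_le h)

theorem norm_le_of_hasFDerivAt_of_sub_le {f : E → ℝ} {f' : E →L[ℝ] ℝ} {C : ℝ} (hC : 0 ≤ C)
    (hf : HasFDerivAt f f' Θ₀) (h : ∀ᶠ Θ in 𝓝 Θ₀, f Θ - f Θ₀ ≤ C * ‖Θ - Θ₀‖) : ‖f'‖ ≤ C := by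
  have hle : ∀ v, f' v ≤ C * ‖v‖ := by
    intro v
    have hline : Tendsto (fun t : ℝ => Θ₀ + t • v) (𝓝[>] 0) (𝓝 Θ₀) := by
      have : Continuous fun t : ℝ => Θ₀ + t • v := by fun_prop
      simpa using (this.tendsto 0).mono_left nhdsWithin_le_nhds
    refine le_of_tendsto (hf.hasLineDerivAt v).tendsto_slope_zero_right ?_
    filter_upwards [hline.eventually h, self_mem_nhdsWithin] with t ht (ht0 : 0 < t)
    rw [add_sub_cancel_left, norm_smul, Real.norm_of_nonneg ht0.le] at ht
    rw [smul_eq_mul, inv_mul_le_iff₀ ht0]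
    linarith
  refine f'.opNorm_le_bound hC fun v => abs_le.2 ⟨?_, hle v⟩
  have := hle (-v)
  rw [map_neg, norm_neg] at this
  linarith

theorem hasNoJump_of_sub_le {Δ : ℝ → E →L[ℝ] ℝ} {K : ℝ} (hK : 0 ≤ K)
    (h : ∀ᶠ q in across T B τ, ∃ f : E → ℝ, HasFDerivAt f (Δ q.2 - Δ q.1) Θ₀ ∧
      ∀ᶠ Θ in 𝓝 Θ₀, f Θ - f Θ₀ ≤ K * (q.2 - q.1) * ‖Θ - Θ₀‖) :
    HasNoJump T B Δ τ := by
  have hlim : Tendsto (fun q : ℝ × ℝ => K * (q.2 - q.1)) (across T B τ) (𝓝 0) := by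
    have hsub := (((tendsto_snd.mono_right nhdsWithin_le_nhds).sub
      (tendsto_fst.mono_right nhdsWithin_le_nhds)).const_mul K : Tendsto _ (across T B τ) _)
    rwa [sub_self, mul_zero] at hsub
  refine squeeze_zero_norm' ?_ hlim
  filter_upwards [h, eventually_mem_across] with q ⟨f, hf, hle⟩ hq
  exact norm_le_of_hasFDerivAt_of_sub_le
    (mul_nonneg hK (sub_nonneg.2 (hq.1.2.trans (le_of_lt hq.2.2)))) hf hle

theorem eventuallyConst_paramDeriv {φ φ' : E → ℝ → ℝ} {c : ℝ → ℝ}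
    (hφ : ∀ᶠ Θ in 𝓝 Θ₀, IsPrimitive T (φ Θ) (φ' Θ))
    (h : ∀ᶠ q in 𝓝 Θ₀ ×ˢ 𝓝[Icc 0 T] τ, φ' q.1 q.2 = c q.2) :
    EventuallyConst (paramDeriv φ Θ₀) (𝓝[Icc 0 T] τ) := by
  have hle : ∀ᶠ q in 𝓝[Icc 0 T] τ ×ˢ 𝓝[Icc 0 T] τ, q.1 ≤ q.2 →
      paramDeriv φ Θ₀ q.1 = paramDeriv φ Θ₀ q.2 := by
    filter_upwards [eventually_forall_Icc_of_eventually_prod (R := fun Θ s => φ' Θ s = c s) h,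
      eventually_mem_nhdsWithin.prod_mk eventually_mem_nhdsWithin] with ⟨u, v⟩ hrate hmem huv
    have hdiff : (fun Θ => φ Θ u) =ᶠ[𝓝 Θ₀] fun Θ => φ Θ v + (φ Θ₀ u - φ Θ₀ v) := by
      filter_upwards [hrate, hφ] with Θ hΘ hprim
      have := hprim.sub_eq_sub hφ.self_of_nhds hmem.1.1 huv hmem.2.2 fun s hs =>
        (hΘ s (Ioo_subset_Icc_self hs)).trans
          (hrate.self_of_nhds s (Ioo_subset_Icc_self hs)).symm
      linarith
    rw [paramDeriv, hdiff.fderiv_eq, fderiv_add_const, paramDeriv]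
  refine eventuallyConst_of_eventually_prod ?_
  filter_upwards [hle, tendsto_prod_swap.eventually hle] with q h₁ h₂
  exact (le_total q.1 q.2).elim h₁ fun h => (h₂ h).symm

end ParamDeriv

/-! ### Hitting and leaving zero -/

section ZeroSets

variable {T τ : ℝ} {h : ℝ → ℝ}

theorem exists_hitsZero_of_pos_of_nonpos (hc : ContinuousOn h (Icc 0 T))
    (hn : ∀ t ∈ Icc 0 T, 0 ≤ h t) {s t : ℝ} (hs : 0 ≤ s) (ht : t ≤ T) (hst : s ≤ t)
    (hpos : 0 < h s) (hz : h t ≤ 0) : ∃ τ ∈ Ioc s t, HitsZero T h τ := by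
  obtain ⟨τ, hτ, h0, hbef⟩ := exists_isFirst_nonpos (hc.mono (Icc_subset_Icc hs ht)) hpos
    ⟨t, right_mem_Icc.2 hst, hz⟩
  refine ⟨τ, hτ, hs.trans_lt hτ.1, hτ.2.trans ht, le_antisymm h0
    (hn τ ⟨hs.trans hτ.1.le, hτ.2.trans ht⟩), ?_⟩
  filter_upwards [Ioo_mem_nhdsLT hτ.1] with u hu
  exact hbef u ⟨hu.1.le, hu.2⟩

theorem eventually_zero_or_pos_nhdsGT (hc : ContinuousOn h (Icc 0 T))
    (hn : ∀ t ∈ Icc 0 T, 0 ≤ h t) (hfin : {τ | HitsZero T h τ}.Finite)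
    (hτ : τ ∈ Ico 0 T) : (∀ᶠ u in 𝓝[>] τ, h u = 0) ∨ ∀ᶠ u in 𝓝[>] τ, 0 < h u := by
  obtain ⟨b, hb, hbB⟩ := (mem_nhdsGT_iff_exists_Ioo_subset' hτ.2).1
    ((eventually_notMem_nhdsGT hfin τ).and (Ioo_mem_nhdsGT hτ.2))
  by_cases hz : ∃ u ∈ Ioo τ b, h u = 0
  · left
    obtain ⟨u, hu, hu0⟩ := hz
    filter_upwards [Ioo_mem_nhdsGT hu.1] with s hs
    by_contra hne
    have hsI : s ∈ Icc 0 T := ⟨hτ.1.trans hs.1.le, (hs.2.trans (hbB hu).2.2).le⟩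
    obtain ⟨τ', hτ', hhit⟩ := exists_hitsZero_of_pos_of_nonpos hc hn hsI.1 (hbB hu).2.2.le hs.2.le
      ((hn s hsI).lt_of_ne' hne) hu0.le
    exact (hbB ⟨hs.1.trans hτ'.1, hτ'.2.trans_lt hu.2⟩).1 hhit
  · right
    push Not at hz
    filter_upwards [Ioo_mem_nhdsGT hb] with u hu
    exact (hn u ⟨hτ.1.trans hu.1.le, (hbB hu).2.2.le⟩).lt_of_ne' (hz u hu)

theorem eventually_zero_or_pos_nhdsLT (hc : ContinuousOn h (Icc 0 T))
    (hn : ∀ t ∈ Icc 0 T, 0 ≤ h t) (hfin : {τ | HitsZero T h τ}.Finite)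
    (hτ : τ ∈ Ioc 0 T) : (∀ᶠ u in 𝓝[<] τ, h u = 0) ∨ ∀ᶠ u in 𝓝[<] τ, 0 < h u := by
  obtain ⟨b, hb, hbB⟩ := (mem_nhdsLT_iff_exists_Ioo_subset' hτ.1).1
    ((eventually_notMem_nhdsLT hfin τ).and (Ioo_mem_nhdsLT hτ.1))
  by_cases hz : ∃ u ∈ Ioo b τ, 0 < h u
  · right
    obtain ⟨u, hu, hu0⟩ := hz
    filter_upwards [Ioo_mem_nhdsLT hu.2] with s hs
    by_contra! hne
    obtain ⟨τ', hτ', hhit⟩ := exists_hitsZero_of_pos_of_nonpos hc hn (hbB hu).2.1.le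
      (hs.2.le.trans hτ.2) hs.1.le hu0 hne
    exact (hbB ⟨hu.1.trans hτ'.1, hτ'.2.trans_lt hs.2⟩).1 hhit
  · left
    push Not at hz
    filter_upwards [Ioo_mem_nhdsLT hb] with u hu
    exact le_antisymm (hz u hu) (hn u ⟨(hbB hu).2.1.le, hu.2.le.trans hτ.2⟩)

theorem eventually_zero_of_le_of_not_hits (hc : ContinuousOn h (Icc 0 T))
    (hn : ∀ t ∈ Icc 0 T, 0 ≤ h t) (hfin : {τ | HitsZero T h τ}.Finite)
    (hτ : τ ∈ Icc 0 T) (h0 : h τ = 0) (hh : ¬ HitsZero T h τ) :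
    ∀ᶠ u in 𝓝[Icc 0 T] τ, u ≤ τ → h u = 0 := by
  refine (eventually_nhdsWithin_Icc_iff hτ).2 ⟨fun _ => h0, fun hp => ?_, fun _ => ?_⟩
  · exact ((eventually_zero_or_pos_nhdsLT hc hn hfin ⟨hp, hτ.2⟩).resolve_right
      fun h' => hh ⟨hp, hτ.2, h0, h'⟩).mono fun _ hu _ => hu
  · filter_upwards [self_mem_nhdsWithin] with u (hu : τ < u) hle using absurd hle hu.not_ge

theorem eventually_zero_of_not_hits_of_not_leaves (hc : ContinuousOn h (Icc 0 T))
    (hn : ∀ t ∈ Icc 0 T, 0 ≤ h t) (hfin : {τ | HitsZero T h τ}.Finite)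
    (hτ : τ ∈ Icc 0 T) (h0 : h τ = 0) (hh : ¬ HitsZero T h τ) (hl : ¬ LeavesZero T h τ) :
    ∀ᶠ u in 𝓝[Icc 0 T] τ, h u = 0 := by
  refine (eventually_nhdsWithin_Icc_iff hτ).2 ⟨h0, fun hp => ?_, fun hp => ?_⟩
  · exact (eventually_zero_or_pos_nhdsLT hc hn hfin ⟨hp, hτ.2⟩).resolve_right
      fun h' => hh ⟨hp, hτ.2, h0, h'⟩
  · exact (eventually_zero_or_pos_nhdsGT hc hn hfin ⟨hτ.1, hp⟩).resolve_right
      fun hpos => hl ⟨hτ.1, hp, h0, hpos⟩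

theorem pos_of_pos_of_hitsZero_of_leavesZero {h₁ h₂ : ℝ → ℝ}
    (hc₁ : ContinuousOn h₁ (Icc 0 T)) (hn₁ : ∀ t ∈ Icc 0 T, 0 ≤ h₁ t)
    (hc₂ : ContinuousOn h₂ (Icc 0 T)) (hn₂ : ∀ t ∈ Icc 0 T, 0 ≤ h₂ t)
    (h0 : 0 < h₁ 0 → 0 < h₂ 0)
    (hhit : ∀ τ, HitsZero T h₂ τ → HitsZero T h₁ τ)
    (hleave : ∀ τ, LeavesZero T h₁ τ → ∀ᶠ u in 𝓝[>] τ, 0 < h₂ u)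
    {t : ℝ} (ht : t ∈ Icc 0 T) (hpos : 0 < h₁ t) : 0 < h₂ t := by
  by_contra! hz
  have hc : ContinuousOn h₁ (Icc 0 t) := hc₁.mono (Icc_subset_Icc_right ht.2)
  by_cases hex : ∃ s ∈ Icc 0 t, h₁ s ≤ 0
  · obtain ⟨ζ, hζ, hζ0, hafter⟩ := exists_isLast_nonpos hc hpos hex
    have hleft : LeavesZero T h₁ ζ := by
      refine ⟨hζ.1, hζ.2.trans_le ht.2, le_antisymm hζ0 (hn₁ ζ ⟨hζ.1, hζ.2.le.trans ht.2⟩), ?_⟩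
      filter_upwards [Ioo_mem_nhdsGT hζ.2] with u hu
      exact hafter u ⟨hu.1, hu.2.le⟩
    obtain ⟨s, hs1, hs2⟩ := ((hleave ζ hleft).and (Ioo_mem_nhdsGT hζ.2)).exists
    obtain ⟨τ, hτ, hτh⟩ := exists_hitsZero_of_pos_of_nonpos hc₂ hn₂ (hζ.1.trans hs2.1.le) ht.2
      hs2.2.le hs1 hz
    exact (hafter τ ⟨hs2.1.trans hτ.1, hτ.2⟩).ne' (hhit τ hτh).2.2.1
  · push Not at hex
    obtain ⟨τ, hτ, hτh⟩ := exists_hitsZero_of_pos_of_nonpos hc₂ hn₂ le_rfl ht.2 ht.1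
      (h0 (hex 0 (left_mem_Icc.2 ht.1))) hz
    exact (hex τ ⟨hτ.1.le, hτ.2⟩).ne' (hhit τ hτh).2.2.1

theorem eventually_paramDeriv_eq_zero {E : Type*} [NormedAddCommGroup E] [NormedSpace ℝ E]
    {Θ₀ : E} {φ : E → ℝ → ℝ} (hc : ContinuousOn (φ Θ₀) (Icc 0 T))
    (hn : ∀ᶠ Θ in 𝓝 Θ₀, ∀ t ∈ Icc 0 T, 0 ≤ φ Θ t) (hfin : {τ | HitsZero T (φ Θ₀) τ}.Finite)
    (hτ : τ ∈ Icc 0 T) (h0 : φ Θ₀ τ = 0) (hl : ¬ LeavesZero T (φ Θ₀) τ) :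
    (∀ᶠ u in 𝓝[Icc 0 T] τ, paramDeriv φ Θ₀ u = 0) ∨
      HitsZero T (φ Θ₀) τ ∧ ∀ᶠ u in 𝓝[Ioc τ T] τ, paramDeriv φ Θ₀ u = 0 := by
  have hzero : ∀ t ∈ Icc 0 T, φ Θ₀ t = 0 → paramDeriv φ Θ₀ t = 0 := fun t ht =>
    paramDeriv_eq_zero (hn.mono fun Θ h => h t ht)
  by_cases hh : HitsZero T (φ Θ₀) τ
  · refine .inr ⟨hh, ?_⟩
    rcases hτ.2.eq_or_lt with rfl | hT
    · simp
    have hr := (eventually_zero_or_pos_nhdsGT hc hn.self_of_nhds hfin ⟨hτ.1, hT⟩).resolve_right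
      fun h => hl ⟨hτ.1, hT, h0, h⟩
    filter_upwards [hr.filter_mono (nhdsWithin_mono τ Ioc_subset_Ioi_self),
      self_mem_nhdsWithin] with u hu huI using hzero u ⟨hτ.1.trans huI.1.le, huI.2⟩ hu
  · left
    filter_upwards [eventually_zero_of_not_hits_of_not_leaves hc hn.self_of_nhds hfin hτ h0 hh hl,
      self_mem_nhdsWithin] with u hu huI using hzero u huI hu

end ZeroSets

/-! ### Flow rates and connections -/

instance instFiniteEvent (M N : ℕ) : Finite (Event M N) :=
  Finite.of_equiv _ (proxy_equiv% (Event M N))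

namespace Setting

variable {M N : ℕ} {d : Fin N → ℕ} (S : Setting M N d)

/-- `μ̃_ij P_ij`, the rate at which agent `j` collects from target `i`. -/
noncomputable def inflow (i : Fin M) (j : Fin N) (Θ : Params d) (t a x : ℝ) : ℝ :=
  S.muTilde i j Θ t a x * S.P i j Θ t

/-- `β_ij P_Bj 1[Z_ij > 0]`, the rate at which agent `j` delivers data of target `i`. -/
noncomputable def outflow (i : Fin M) (j : Fin N) (Θ : Params d) (t z : ℝ) : ℝ :=
  if 0 < z then S.β i j * S.PB j Θ t else 0

/-- The total content `X_i + ∑_j Z_ij + Y_i` of the queues of target `i` at time `0`. -/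
noncomputable def initialContent (i : Fin M) (Θ : Params d) : ℝ :=
  S.x₀ i Θ + ∑ j, S.z₀ i j Θ + S.y₀ i Θ

variable {S} {T τ : ℝ} {F : Set (Params d)} {Θ₀ Θ : Params d} {i : Fin M} {j : Fin N}
  {t a x z : ℝ}

theorem inflow_of_conn_ne (h : S.conn Θ t i ≠ some j) : S.inflow i j Θ t a x = 0 := by
  simp [inflow, muTilde, h]

theorem inflow_eq_of_pos {a₁ a₂ x₁ x₂ : ℝ} (h₁ : 0 < x₁) (h₂ : 0 < x₂) :
    S.inflow i j Θ t a₁ x₁ = S.inflow i j Θ t a₂ x₂ := by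
  simp [inflow, muTilde, h₁.ne', h₂.ne']

theorem outflow_of_pos (hz : 0 < z) : S.outflow i j Θ t z = S.β i j * S.PB j Θ t := if_pos hz

theorem outflow_of_PB_eq_zero (h : S.PB j Θ t = 0) : S.outflow i j Θ t z = 0 := by
  simp [outflow, h]

theorem drain_of_conn_eq_some (h : S.conn Θ t i = some j) :
    S.drain i Θ t = S.μ i j * S.P i j Θ t := by
  simp [drain, h]

theorem drain_of_conn_eq_none (h : S.conn Θ t i = none) : S.drain i Θ t = 0 := by
  simp [drain, h]

theorem Xdot_of_pos (hx : 0 < x) : S.Xdot i Θ t a x = a - S.drain i Θ t := by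
  simp [Xdot, hx.ne']

theorem sub_drain_le_Xdot : a - S.drain i Θ t ≤ S.Xdot i Θ t a x := by
  unfold Xdot
  split_ifs with h
  · linarith [h.2]
  · exact le_rfl

namespace Admissible

section Rates

variable (hS : S.Admissible T F Θ₀)
include hS

theorem P_nonneg : 0 ≤ S.P i j Θ t := by
  rw [← hS.p_zero i j (max (S.D i j Θ t) (S.r i j + 1)) (le_max_of_le_left dist_nonneg)
    ((lt_add_one _).trans_le (le_max_right _ _))]
  exact hS.p_anti i j dist_nonneg (le_max_of_le_left dist_nonneg) (le_max_left _ _)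

theorem PB_nonneg : 0 ≤ S.PB j Θ t := by
  rw [← hS.pB_zero j (max (S.DB j Θ t) (S.rB j + 1)) (le_max_of_le_left dist_nonneg)
    ((lt_add_one _).trans_le (le_max_right _ _))]
  exact hS.pB_anti j dist_nonneg (le_max_of_le_left dist_nonneg) (le_max_left _ _)

theorem P_eq_zero (h : S.r i j < S.D i j Θ t) : S.P i j Θ t = 0 :=
  hS.p_zero i j _ dist_nonneg h

theorem rB_lt_DB (h : S.D i j Θ t ≤ S.r i j) : S.rB j < S.DB j Θ t := by
  have hsep := hS.separated i j
  have htri := dist_triangle_right (S.w i) S.wB (S.s j Θ t)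
  simp only [D, DB] at h ⊢
  linarith

theorem PB_eq_zero (h : S.D i j Θ t ≤ S.r i j) : S.PB j Θ t = 0 :=
  hS.pB_zero j _ dist_nonneg (hS.rB_lt_DB h)

theorem conn_ne_of_lt (hΘ : Θ ∈ F) (ht : t ∈ Icc 0 T) (h : S.r i j < S.D i j Θ t) :
    S.conn Θ t i ≠ some j := fun h' => (hS.conn_range Θ hΘ t ht i j h').not_gt h

theorem drain_nonneg : 0 ≤ S.drain i Θ t := by
  rcases hc : S.conn Θ t i with _ | j
  · rw [drain_of_conn_eq_none hc]
  · rw [drain_of_conn_eq_some hc]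
    exact mul_nonneg (hS.μ_nonneg i j) hS.P_nonneg

theorem exists_drain_le (i : Fin M) : ∃ L, ∀ Θ t, S.drain i Θ t ≤ L := by
  have hle : ∀ j Θ t, S.μ i j * S.P i j Θ t ≤ S.μ i j * S.p i j 0 := fun j Θ t =>
    mul_le_mul_of_nonneg_left (hS.p_anti i j self_mem_Ici dist_nonneg dist_nonneg)
      (hS.μ_nonneg i j)
  have h0 : ∀ j, 0 ≤ S.μ i j * S.p i j 0 := fun j =>
    (mul_nonneg (hS.μ_nonneg i j) hS.P_nonneg).trans (hle j Θ₀ 0)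
  refine ⟨∑ j, S.μ i j * S.p i j 0, fun Θ t => ?_⟩
  rcases hc : S.conn Θ t i with _ | j
  · rw [drain_of_conn_eq_none hc]
    exact Finset.sum_nonneg fun j _ => h0 j
  · rw [drain_of_conn_eq_some hc]
    exact (hle j Θ t).trans (Finset.single_le_sum (fun j _ => h0 j) (Finset.mem_univ j))

theorem Xdot_le (ha : 0 ≤ a) : S.Xdot i Θ t a x ≤ a := by
  have := hS.drain_nonneg (i := i) (Θ := Θ) (t := t)
  unfold Xdot
  split_ifs <;> linarith

theorem inflow_of_conn_eq (h : S.conn Θ t i = some j) (ha : 0 ≤ a) :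
    S.inflow i j Θ t a x = a - S.Xdot i Θ t a x := by
  simp only [inflow, muTilde, Xdot, drain_of_conn_eq_some h, h, if_true]
  rcases (hS.P_nonneg (i := i) (j := j) (Θ := Θ) (t := t)).eq_or_lt with hP | hP
  · simp only [← hP, mul_zero, sub_zero]
    split_ifs with hx
    · linarith [hx.2]
    · exact (sub_self a).symm
  · simp only [hP, and_true, ite_mul]
    rw [min_mul_of_nonneg _ _ hP.le, div_mul_cancel₀ _ hP.ne']
    split_ifs with hx hle <;> grind

theorem inflow_nonneg (ha : 0 ≤ a) : 0 ≤ S.inflow i j Θ t a x := by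
  refine mul_nonneg ?_ hS.P_nonneg
  unfold muTilde
  split_ifs with hc hx
  · exact le_min (div_nonneg ha hx.2.le) (hS.μ_nonneg i j)
  · exact hS.μ_nonneg i j
  · exact le_rfl

theorem inflow_le : S.inflow i j Θ t a x ≤ S.μ i j * S.P i j Θ t := by
  refine mul_le_mul_of_nonneg_right ?_ hS.P_nonneg
  unfold muTilde
  split_ifs
  · exact min_le_right _ _
  · exact le_rfl
  · exact hS.μ_nonneg i j

theorem sum_inflow (ha : 0 ≤ a) {A : Finset (Fin N)} (hA : ∀ j, S.conn Θ t i = some j → j ∈ A) :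
    ∑ j ∈ A, S.inflow i j Θ t a x = a - S.Xdot i Θ t a x := by
  rcases hc : S.conn Θ t i with _ | j
  · rw [Finset.sum_eq_zero fun j _ => inflow_of_conn_ne (by simp [hc])]
    simp only [Xdot, drain_of_conn_eq_none hc, sub_zero]
    split_ifs with h
    · linarith [h.2]
    · exact (sub_self a).symm
  · rw [Finset.sum_eq_single_of_mem j (hA j hc) fun l _ hl =>
      inflow_of_conn_ne (by simpa [hc] using hl.symm)]
    exact hS.inflow_of_conn_eq hc ha

theorem inflow_le_sub_Xdot (ha : 0 ≤ a) : S.inflow i j Θ t a x ≤ a - S.Xdot i Θ t a x := by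
  by_cases h : S.conn Θ t i = some j
  · exact (hS.inflow_of_conn_eq h ha).le
  · rw [inflow_of_conn_ne h]
    exact sub_nonneg.2 (hS.Xdot_le ha)

theorem outflow_nonneg : 0 ≤ S.outflow i j Θ t z := by
  unfold outflow
  split_ifs
  · exact mul_nonneg (hS.β_nonneg i j) hS.PB_nonneg
  · exact le_rfl

theorem outflow_le : S.outflow i j Θ t z ≤ S.β i j * S.pB j 0 := by
  have hle : S.β i j * S.PB j Θ t ≤ S.β i j * S.pB j 0 := mul_le_mul_of_nonneg_left
    (hS.pB_anti j self_mem_Ici dist_nonneg dist_nonneg) (hS.β_nonneg i j)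
  unfold outflow
  split_ifs
  · exact hle
  · exact (mul_nonneg (hS.β_nonneg i j) hS.PB_nonneg).trans hle

theorem Zdot_eq (hΘ : Θ ∈ F) (ht : t ∈ Icc 0 T) (ha : 0 ≤ a) (hz : 0 ≤ z) :
    S.Zdot i j Θ t a x z = S.inflow i j Θ t a x - S.outflow i j Θ t z := by
  change (if z = 0 ∧ S.inflow i j Θ t a x - S.β i j * S.PB j Θ t ≤ 0 then 0
    else S.inflow i j Θ t a x - S.β i j * S.PB j Θ t) = _
  have hin := hS.inflow_nonneg (i := i) (j := j) (Θ := Θ) (t := t) (x := x) ha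
  rcases hz.eq_or_lt with rfl | hz
  · rw [outflow, if_neg (lt_irrefl 0), sub_zero]
    -- A connected agent is out of range of the base, and an agent that is not connected collects
    -- nothing, so only one of the two terms of the net flow can be nonzero.
    by_cases hc : S.conn Θ t i = some j
    · rw [hS.PB_eq_zero (hS.conn_range Θ hΘ t ht i j hc), mul_zero, sub_zero]
      split_ifs with h
      · exact le_antisymm hin h.2
      · rfl
    · have := mul_nonneg (hS.β_nonneg i j) (hS.PB_nonneg (j := j) (Θ := Θ) (t := t))
      rw [inflow_of_conn_ne hc, if_pos ⟨rfl, by linarith⟩]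
  · rw [outflow_of_pos hz, if_neg fun h => hz.ne' h.1]

end Rates

section Nearby

variable (hS : S.Admissible T F Θ₀) (hF : F ∈ 𝓝 Θ₀) (hτ : τ ∈ Icc 0 T)
include hS hτ

theorem eventually_conn_eq
    (h : ∀ j, ¬ HitsZero T (S.Dplus i j Θ₀) τ ∧ ¬ LeavesZero T (S.Dplus i j Θ₀) τ) :
    ∀ᶠ q in 𝓝 Θ₀ ×ˢ 𝓝[Icc 0 T] τ, S.conn q.1 q.2 i = S.conn Θ₀ τ i := by
  have := hS.conn_locConst i τ hτ h
  rwa [nhdsWithin_prod_eq, nhdsWithin_univ] at this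

include hF

theorem tendsto_s (j : Fin N) :
    Tendsto (fun q : Params d × ℝ => S.s j q.1 q.2) (𝓝 Θ₀ ×ˢ 𝓝[Icc 0 T] τ) (𝓝 (S.s j Θ₀ τ)) := by
  obtain ⟨K, V, hV, hK⟩ := hS.s_lip j
  refine ((hS.s_cont j Θ₀ (mem_of_mem_nhds hF) τ hτ).tendsto.comp tendsto_snd).congr_dist ?_
  have hlim : Tendsto (fun q : Params d × ℝ => (K : ℝ) * dist Θ₀ q.1) (𝓝 Θ₀ ×ˢ 𝓝[Icc 0 T] τ)
      (𝓝 0) := by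
    have := (tendsto_const_nhds (x := Θ₀)).dist
      (tendsto_fst (f := 𝓝 Θ₀) (g := 𝓝[Icc 0 T] τ)) |>.const_mul (K : ℝ)
    rwa [dist_self, mul_zero] at this
  refine squeeze_zero' (Eventually.of_forall fun _ => dist_nonneg) ?_ hlim
  filter_upwards [(eventually_mem_set.2 hV).prod_mk (self_mem_nhdsWithin : Icc 0 T ∈ 𝓝[Icc 0 T] τ)]
    with q hq using (hK q.2 hq.2).dist_le_mul Θ₀ (mem_of_mem_nhds hV) q.1 hq.1

theorem eventually_r_lt_D (h : S.r i j < S.D i j Θ₀ τ) :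
    ∀ᶠ q in 𝓝 Θ₀ ×ˢ 𝓝[Icc 0 T] τ, S.r i j < S.D i j q.1 q.2 :=
  (tendsto_const_nhds.dist (hS.tendsto_s hF hτ j)).eventually_const_lt h

theorem eventually_conn_ne (h : S.r i j < S.D i j Θ₀ τ) :
    ∀ᶠ q in 𝓝 Θ₀ ×ˢ 𝓝[Icc 0 T] τ, S.conn q.1 q.2 i ≠ some j := by
  filter_upwards [hS.eventually_r_lt_D hF hτ h,
    (eventually_mem_set.2 hF).prod_mk (self_mem_nhdsWithin : Icc 0 T ∈ 𝓝[Icc 0 T] τ)] with q hq hmem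
    using hS.conn_ne_of_lt hmem.1 hmem.2 hq

theorem eventually_PB_eq_zero (h : S.D i j Θ₀ τ ≤ S.r i j) :
    ∀ᶠ q in 𝓝 Θ₀ ×ˢ 𝓝[Icc 0 T] τ, S.PB j q.1 q.2 = 0 :=
  ((tendsto_const_nhds.dist (hS.tendsto_s hF hτ j)).eventually_const_lt (hS.rB_lt_DB h)).mono
    fun _ => hS.pB_zero j _ dist_nonneg

end Nearby

section Lipschitz

variable (hS : S.Admissible T F Θ₀)
include hS

theorem continuousOn_Dplus (hF : F ∈ 𝓝 Θ₀) (i : Fin M) (j : Fin N) :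
    ContinuousOn (S.Dplus i j Θ₀) (Icc 0 T) :=
  continuousOn_const.sup (ContinuousOn.sub (fun t ht => tendsto_const_nhds.dist
    (hS.s_cont j Θ₀ (mem_of_mem_nhds hF) t ht)) continuousOn_const)

theorem eventually_r_lt_D_of_disconnects (hF : F ∈ 𝓝 Θ₀)
    (hfin : {τ | HitsZero T (S.Dplus i j Θ₀) τ}.Finite) (h0 : 0 < τ) (hτ : τ ≤ T)
    (hD : S.D i j Θ₀ τ ≤ S.r i j)
    (hbefore : ∀ᶠ s in 𝓝[Icc 0 T] τ, s < τ → S.conn Θ₀ s i = some j)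
    (hafter : ∀ᶠ s in 𝓝[Icc 0 T] τ, τ < s → S.conn Θ₀ s i ≠ some j) :
    ∀ᶠ s in 𝓝[Icc 0 T] τ, τ < s → S.r i j < S.D i j Θ₀ s := by
  have hτI : τ ∈ Icc 0 T := ⟨h0.le, hτ⟩
  refine (eventually_nhdsWithin_Icc_iff hτI).2 ⟨fun h => absurd h (lt_irrefl τ), fun _ => ?_,
    fun hT => ?_⟩
  · filter_upwards [self_mem_nhdsWithin] with s (hs : s < τ) h using absurd h hs.not_gt
  rcases eventually_zero_or_pos_nhdsGT (hS.continuousOn_Dplus hF i j) (fun _ _ => le_max_left _ _)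
    hfin ⟨h0.le, hT⟩ with hin | hout
  · have hrange : ∀ᶠ s in 𝓝[Icc 0 T] τ, τ < s → S.Dplus i j Θ₀ s = 0 :=
      nhdsWithin_le_nhds (eventually_nhdsWithin_iff.1 hin)
    have hIcc := eventually_forall_Icc (hbefore.and (hafter.and hrange))
    obtain ⟨⟨u, v⟩, h, hu, hv⟩ := ((hIcc.filter_mono (prod_mono
      (nhdsWithin_le_of_mem (Icc_mem_nhdsLT_of_mem_Ioc ⟨h0, hτ⟩))
      (nhdsWithin_le_of_mem (Icc_mem_nhdsGT_of_mem_Ico ⟨h0.le, hT⟩)))).and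
      ((eventually_mem_set.2 (Ioo_mem_nhdsLT h0)).prod_mk
        (eventually_mem_set.2 (Ioo_mem_nhdsGT hT)))).exists
    have huv := (hu.2.trans hv.1).le
    have huT : u ∈ Icc 0 T := ⟨hu.1.le, hu.2.le.trans hτ⟩
    have hF₀ := mem_of_mem_nhds hF
    refine absurd (hS.conn_persist Θ₀ hF₀ u huT v ⟨huv, hv.2.le⟩ i j
      ((h u (left_mem_Icc.2 huv)).1 hu.2) fun s hs => ?_) ((h v (right_mem_Icc.2 huv)).2.1 hv.1)
    rcases lt_trichotomy s τ with hlt | rfl | hgt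
    · exact hS.conn_range Θ₀ hF₀ s ⟨huT.1.trans hs.1, hlt.le.trans hτ⟩ i j ((h s hs).1 hlt)
    · exact hD
    · exact sub_nonpos.1 (max_eq_left_iff.1 ((h s hs).2.2 hgt))
  · exact hout.mono fun s hs _ => sub_pos.1 ((lt_max_iff.1 hs).resolve_left (lt_irrefl 0))

theorem exists_mul_P_sub_le (i : Fin M) (j : Fin N) :
    ∃ K, 0 ≤ K ∧ ∀ᶠ Θ in 𝓝 Θ₀, ∀ t ∈ Icc 0 T,
      |S.μ i j * S.P i j Θ t - S.μ i j * S.P i j Θ₀ t| ≤ K * ‖Θ - Θ₀‖ := by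
  obtain ⟨K₁, hK₁⟩ := hS.p_lip i j
  obtain ⟨K₂, V, hV, hK₂⟩ := hS.s_lip j
  refine ⟨S.μ i j * (K₁ * K₂), mul_nonneg (hS.μ_nonneg i j) (by positivity), ?_⟩
  filter_upwards [hV] with Θ hΘ t ht
  calc |S.μ i j * S.P i j Θ t - S.μ i j * S.P i j Θ₀ t|
      = S.μ i j * dist (S.P i j Θ t) (S.P i j Θ₀ t) := by
        rw [← mul_sub, abs_mul, abs_of_nonneg (hS.μ_nonneg i j), Real.dist_eq]
    _ ≤ S.μ i j * (K₁ * (K₂ * dist Θ Θ₀)) := by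
        gcongr
        · exact hS.μ_nonneg i j
        · refine (hK₁.dist_le_mul _ dist_nonneg _ dist_nonneg).trans ?_
          gcongr
          exact (dist_dist_dist_le_right _ _ _).trans
            ((hK₂ t ht).dist_le_mul Θ hΘ Θ₀ (mem_of_mem_nhds hV))
    _ = S.μ i j * (K₁ * K₂) * ‖Θ - Θ₀‖ := by rw [dist_eq_norm]; ring

theorem exists_drain_sub_le (hτ : τ ∈ Icc 0 T)
    (h : ∀ j, ¬ HitsZero T (S.Dplus i j Θ₀) τ ∧ ¬ LeavesZero T (S.Dplus i j Θ₀) τ) :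
    ∃ K, 0 ≤ K ∧ ∀ᶠ q in 𝓝 Θ₀ ×ˢ 𝓝[Icc 0 T] τ,
      S.drain i Θ₀ q.2 - S.drain i q.1 q.2 ≤ K * ‖q.1 - Θ₀‖ := by
  have hconn := hS.eventually_conn_eq hτ h
  have hconn₀ := (eventually_of_eventually_prod
    (R := fun Θ t => S.conn Θ t i = S.conn Θ₀ τ i) hconn).prod_inr (𝓝 Θ₀)
  rcases hc : S.conn Θ₀ τ i with _ | j <;> rw [hc] at hconn hconn₀
  · refine ⟨0, le_rfl, ?_⟩
    filter_upwards [hconn, hconn₀] with q hq hq₀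
    simp only [drain_of_conn_eq_none hq, drain_of_conn_eq_none hq₀, sub_self, zero_mul, le_refl]
  · obtain ⟨K, hK, hle⟩ := hS.exists_mul_P_sub_le i j
    refine ⟨K, hK, ?_⟩
    filter_upwards [hconn, hconn₀, hle.prod_mk
      (self_mem_nhdsWithin : Icc 0 T ∈ 𝓝[Icc 0 T] τ)] with q hq hq₀ hmem
    rw [drain_of_conn_eq_some hq, drain_of_conn_eq_some hq₀]
    exact (le_abs_self _).trans ((abs_sub_comm _ _).trans_le (hmem.1 q.2 hmem.2))

end Lipschitz

end Admissible

namespace IsStatePath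

variable {a x y : Fin M → ℝ → ℝ} {z : Fin M → Fin N → ℝ → ℝ} (h : S.IsStatePath T Θ a x z y)
include h

theorem isPrimitive_x (i : Fin M) :
    IsPrimitive T (x i) fun t => S.Xdot i Θ t (a i t) (x i t) := by
  obtain ⟨C, hC, hdyn⟩ := h.dynamics
  exact ⟨h.x_cont i, (eventually_mem_set.2 hC.compl_mem_cofinite).mono fun t htC ht =>
    (hdyn t ⟨ht, htC⟩).1 i⟩

theorem isPrimitive_y (i : Fin M) :
    IsPrimitive T (y i) fun t => ∑ j, S.outflow i j Θ t (z i j t) := by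
  obtain ⟨C, hC, hdyn⟩ := h.dynamics
  exact ⟨h.y_cont i, (eventually_mem_set.2 hC.compl_mem_cofinite).mono fun t htC ht =>
    (hdyn t ⟨ht, htC⟩).2.2 i⟩

theorem isPrimitive_z (hS : S.Admissible T F Θ₀) (hΘ : Θ ∈ F) (ha : ∀ i, ∀ t ∈ Icc 0 T, 0 ≤ a i t)
    (i : Fin M) (j : Fin N) : IsPrimitive T (z i j) fun t =>
      S.inflow i j Θ t (a i t) (x i t) - S.outflow i j Θ t (z i j t) := by
  obtain ⟨C, hC, hdyn⟩ := h.dynamics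
  refine ⟨h.z_cont i j, (eventually_mem_set.2 hC.compl_mem_cofinite).mono fun t htC ht => ?_⟩
  have htI := Ioo_subset_Icc_self ht
  rw [← hS.Zdot_eq hΘ htI (ha i t htI) (h.z_nonneg i j t htI)]
  exact (hdyn t ⟨ht, htC⟩).2.1 i j

end IsStatePath

/-! ### Two realizations with the same event record -/

variable (S) in
/-- The queue contents of one realization, for all feasible parameters, whose event record under
the observed parameter `Θ₀` is `E`. Realizations are bundled, with the record as a parameter of the
type, so that two of them with the same record can be compared. -/
structure ObservedPath (T : ℝ) (F : Set (Params d)) (Θ₀ : Params d)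
    (E : Event M N → Set ℝ) where
  a : Fin M → ℝ → ℝ
  x : Fin M → Params d → ℝ → ℝ
  z : Fin M → Fin N → Params d → ℝ → ℝ
  y : Fin M → Params d → ℝ → ℝ
  arrival_nonneg : ∀ i, ∀ t ∈ Icc 0 T, 0 ≤ a i t
  state : ∀ Θ ∈ F, S.IsStatePath T Θ a (fun i => x i Θ) (fun i j => z i j Θ) (fun i => y i Θ)
  record : E = S.eventTimes T Θ₀ (fun i => x i Θ₀) (fun i j => z i j Θ₀)
  finite : ∀ e, (E e).Finite
  simple : ∀ e e', (∀ i j, e ≠ .zetaPlus i j) → (∀ i j, e' ≠ .zetaPlus i j) →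
    ∀ τ, τ ∈ E e → τ ∈ E e' → e = e'
  diff : ∀ t ∈ Icc 0 T, (∀ e, t ∉ E e) →
    (∀ i, DifferentiableAt ℝ (fun Θ => x i Θ t) Θ₀) ∧
    ∀ i j, DifferentiableAt ℝ (fun Θ => z i j Θ t) Θ₀

variable {E : Event M N → Set ℝ}

namespace ObservedPath

/-- The rate of change of `Z_ij` along a path, for the parameter `Θ`. -/
noncomputable def zRate (p : S.ObservedPath T F Θ₀ E) (i : Fin M) (j : Fin N) (Θ : Params d)
    (t : ℝ) : ℝ :=
  S.inflow i j Θ t (p.a i t) (p.x i Θ t) - S.outflow i j Θ t (p.z i j Θ t)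

section Paths

variable (p : S.ObservedPath T F Θ₀ E)
include p

theorem mem_iff (e : Event M N) :
    τ ∈ E e ↔ τ ∈ S.eventTimes T Θ₀ (fun i => p.x i Θ₀) (fun i j => p.z i j Θ₀) e := by
  rw [← p.record]

theorem finite_iUnion : (⋃ e, E e).Finite := Set.finite_iUnion p.finite

theorem finite_hitsZero_x (i : Fin M) : {τ | HitsZero T (p.x i Θ₀) τ}.Finite :=
  (p.finite (.xiZero i)).subset fun _ => (p.mem_iff (.xiZero i)).2

theorem finite_hitsZero_z (i : Fin M) (j : Fin N) : {τ | HitsZero T (p.z i j Θ₀) τ}.Finite :=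
  (p.finite (.zetaZero i j)).subset fun _ => (p.mem_iff (.zetaZero i j)).2

theorem finite_hitsZero_Dplus (i : Fin M) (j : Fin N) :
    {τ | HitsZero T (S.Dplus i j Θ₀) τ}.Finite :=
  (p.finite (.deltaZero i j)).subset fun _ => (p.mem_iff (.deltaZero i j)).2

theorem not_delta (h : ∀ j, τ ∉ E (.deltaZero i j) ∧ τ ∉ E (.deltaPlus i j)) (j : Fin N) :
    ¬ HitsZero T (S.Dplus i j Θ₀) τ ∧ ¬ LeavesZero T (S.Dplus i j Θ₀) τ :=
  ⟨fun h' => (h j).1 ((p.mem_iff (.deltaZero i j)).2 h'),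
    fun h' => (h j).2 ((p.mem_iff (.deltaPlus i j)).2 h')⟩

variable (hF : F ∈ 𝓝 Θ₀)
include hF

theorem state_self : S.IsStatePath T Θ₀ p.a (fun i => p.x i Θ₀) (fun i j => p.z i j Θ₀)
    (fun i => p.y i Θ₀) := p.state Θ₀ (mem_of_mem_nhds hF)

theorem eventually_x_nonneg (i : Fin M) : ∀ᶠ Θ in 𝓝 Θ₀, ∀ t ∈ Icc 0 T, 0 ≤ p.x i Θ t := by
  filter_upwards [hF] with Θ hΘ using (p.state Θ hΘ).x_nonneg i

theorem eventually_z_nonneg (i : Fin M) (j : Fin N) :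
    ∀ᶠ Θ in 𝓝 Θ₀, ∀ t ∈ Icc 0 T, 0 ≤ p.z i j Θ t := by
  filter_upwards [hF] with Θ hΘ using (p.state Θ hΘ).z_nonneg i j

theorem isPrimitive_x (i : Fin M) : ∀ᶠ Θ in 𝓝 Θ₀,
    IsPrimitive T (p.x i Θ) fun t => S.Xdot i Θ t (p.a i t) (p.x i Θ t) := by
  filter_upwards [hF] with Θ hΘ using (p.state Θ hΘ).isPrimitive_x i

theorem eventually_x_eq_zero (hτ : τ ∈ Icc 0 T) (h0 : p.x i Θ₀ τ = 0) (hh : τ ∉ E (.xiZero i))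
    (hl : τ ∉ E (.xiPlus i)) : ∀ᶠ u in 𝓝[Icc 0 T] τ, p.x i Θ₀ u = 0 :=
  have h := p.state_self hF
  eventually_zero_of_not_hits_of_not_leaves (h.x_cont i) (h.x_nonneg i) (p.finite_hitsZero_x i)
    hτ h0 (mt (p.mem_iff (.xiZero i)).2 hh) (mt (p.mem_iff (.xiPlus i)).2 hl)

theorem x_pos (q : S.ObservedPath T F Θ₀ E) (ht : t ∈ Icc 0 T) (h : 0 < p.x i Θ₀ t) :
    0 < q.x i Θ₀ t := by
  have hp := p.state_self hF
  have hq := q.state_self hF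
  refine pos_of_pos_of_hitsZero_of_leavesZero (hp.x_cont i) (hp.x_nonneg i) (hq.x_cont i)
    (hq.x_nonneg i) (fun h0 => ?_) (fun τ hτ => ?_) (fun τ hτ => ?_) ht h
  · rwa [hq.x_init, ← hp.x_init]
  · exact (p.mem_iff (.xiZero i)).1 ((q.mem_iff (.xiZero i)).2 hτ)
  · have hq' : LeavesZero T (q.x i Θ₀) τ := (q.mem_iff (.xiPlus i)).1 ((p.mem_iff (.xiPlus i)).2 hτ)
    exact hq'.2.2.2

theorem x_eq_zero (q : S.ObservedPath T F Θ₀ E) (ht : t ∈ Icc 0 T) (h : p.x i Θ₀ t = 0) :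
    q.x i Θ₀ t = 0 :=
  ((q.state_self hF).x_nonneg i t ht).eq_or_lt.elim Eq.symm fun h' =>
    absurd h (q.x_pos hF p ht h').ne'

variable (hS : S.Admissible T F Θ₀)
include hS

theorem isPrimitive_z (i : Fin M) (j : Fin N) : ∀ᶠ Θ in 𝓝 Θ₀, IsPrimitive T (p.z i j Θ)
    (p.zRate i j Θ) := by
  filter_upwards [hF] with Θ hΘ using (p.state Θ hΘ).isPrimitive_z hS hΘ p.arrival_nonneg i j

theorem hasFDerivAt_x (i : Fin M) (ht : t ∈ regularTimes T (⋃ e, E e)) :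
    HasFDerivAt (fun Θ => p.x i Θ t) (paramDeriv (p.x i) Θ₀ t) Θ₀ := by
  refine DifferentiableAt.hasFDerivAt ?_
  rcases ht.2 with rfl | htE
  · refine (hS.x₀_diff i).congr_of_eventuallyEq ?_
    filter_upwards [hF] with Θ hΘ using (p.state Θ hΘ).x_init i
  · exact (p.diff t ht.1 fun e he => htE (mem_iUnion_of_mem e he)).1 i

theorem hasFDerivAt_z (i : Fin M) (j : Fin N) (ht : t ∈ regularTimes T (⋃ e, E e)) :
    HasFDerivAt (fun Θ => p.z i j Θ t) (paramDeriv (p.z i j) Θ₀ t) Θ₀ := by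
  refine DifferentiableAt.hasFDerivAt ?_
  rcases ht.2 with rfl | htE
  · refine (hS.z₀_diff i j).congr_of_eventuallyEq ?_
    filter_upwards [hF] with Θ hΘ using (p.state Θ hΘ).z_init i j
  · exact (p.diff t ht.1 fun e he => htE (mem_iUnion_of_mem e he)).2 i j

theorem eventually_x_pos (hτ : τ ∈ Icc 0 T) (h : 0 < p.x i Θ₀ τ) :
    ∀ᶠ q in 𝓝 Θ₀ ×ˢ 𝓝[Icc 0 T] τ, 0 < p.x i q.1 q.2 := by
  obtain ⟨L, hL⟩ := hS.exists_drain_le i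
  refine eventually_pos_of_neg_le (L := L) p.finite_iUnion (p.isPrimitive_x hF i)
    (fun u hu => (p.hasFDerivAt_x hF hS i hu).continuousAt)
    (.of_forall fun Θ s hs => ?_) hτ h
  have hdot := sub_drain_le_Xdot (S := S) (i := i) (Θ := Θ) (t := s) (a := p.a i s) (x := p.x i Θ s)
  linarith [hL Θ s, p.arrival_nonneg i s hs]

theorem eventually_z_pos (hτ : τ ∈ Icc 0 T) (h : 0 < p.z i j Θ₀ τ) :
    ∀ᶠ q in 𝓝 Θ₀ ×ˢ 𝓝[Icc 0 T] τ, 0 < p.z i j q.1 q.2 := by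
  refine eventually_pos_of_neg_le (L := S.β i j * S.pB j 0) p.finite_iUnion
    (p.isPrimitive_z hF hS i j)
    (fun u hu => (p.hasFDerivAt_z hF hS i j hu).continuousAt)
    (.of_forall fun Θ s hs => ?_) hτ h
  have hin := hS.inflow_nonneg (i := i) (j := j) (Θ := Θ) (t := s) (x := p.x i Θ s)
    (p.arrival_nonneg i s hs)
  have hout := hS.outflow_le (i := i) (j := j) (Θ := Θ) (t := s) (z := p.z i j Θ s)
  rw [zRate]
  linarith

end Paths

section TargetContent

variable (p q : S.ObservedPath T F Θ₀ E) (hF : F ∈ 𝓝 Θ₀) (hS : S.Admissible T F Θ₀)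
include hF hS

/-- Where `X_i` leaves `0` under `Θ₀`, the arrivals are not balanced against the drain under the
other parameters, but the drain is Lipschitz in `Θ`, so the effect on `X_i` is only
`O((v - u) ‖Θ - Θ₀‖)`. -/
theorem hasNoJump_x (hτ : τ ∈ E (.xiPlus i)) :
    HasNoJump T (⋃ e, E e) (paramDeriv (p.x i) Θ₀) τ := by
  have hl : LeavesZero T (p.x i Θ₀) τ := (p.mem_iff (.xiPlus i)).1 hτ
  have hτI : τ ∈ Icc 0 T := ⟨hl.1, hl.2.1.le⟩
  have hother : ∀ e, (∀ i j, e ≠ .zetaPlus i j) → e ≠ .xiPlus i → τ ∉ E e := fun e hz hne he =>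
    hne (p.simple e _ hz (fun _ _ => nofun) τ he hτ)
  obtain ⟨K, hK, hdrain⟩ := hS.exists_drain_sub_le (i := i) hτI (p.not_delta fun j =>
    ⟨hother _ (fun _ _ => nofun) nofun, hother _ (fun _ _ => nofun) nofun⟩)
  have hp := p.state_self hF
  have hzero : ∀ᶠ u in 𝓝[Icc 0 T] τ, u ≤ τ → p.x i Θ₀ u = 0 :=
    eventually_zero_of_le_of_not_hits (hp.x_cont i) (hp.x_nonneg i) (p.finite_hitsZero_x i) hτI
      hl.2.2.1 (mt (p.mem_iff (.xiZero i)).2 (hother _ (fun _ _ => nofun) nofun))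
  refine hasNoJump_of_sub_le (Θ₀ := Θ₀) hK ?_
  filter_upwards [eventually_mem_across, across_le (eventually_forall_Icc_of_eventually_prod
      (R := fun Θ s => S.drain i Θ₀ s - S.drain i Θ s ≤ K * ‖Θ - Θ₀‖) hdrain),
    across_le (hzero.prod_inl (𝓝[Icc 0 T] τ))] with ⟨u, v⟩ ⟨hu, hv⟩ hrate hu0
  refine ⟨_, (p.hasFDerivAt_x hF hS i hv.1).sub (p.hasFDerivAt_x hF hS i hu.1), ?_⟩
  filter_upwards [hrate, p.isPrimitive_x hF i, p.eventually_x_nonneg hF i] with Θ hΘ hprim hnn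
  have hu0 : p.x i Θ₀ u = 0 := hu0 hu.2
  have hle := (hprim.sub (p.isPrimitive_x hF i).self_of_nhds).le_max_add_mul_sub
    (c := K * ‖Θ - Θ₀‖) (by positivity) hu.1.1.1 (hu.2.trans hv.2.le) hv.1.1.2 fun s hs hpos => by
      have hsI : s ∈ Icc 0 T := ⟨hu.1.1.1.trans hs.1.le, hs.2.le.trans hv.1.1.2⟩
      rw [Xdot_of_pos ((hp.x_nonneg i s hsI).trans_lt (sub_pos.1 hpos))]
      linarith [hΘ s (Ioo_subset_Icc_self hs),
        sub_drain_le_Xdot (S := S) (i := i) (Θ := Θ₀) (t := s) (a := p.a i s) (x := p.x i Θ₀ s)]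
  rw [hu0, sub_zero, max_eq_left (hnn u hu.1.1)] at hle
  simp only [Pi.sub_apply]
  linarith

theorem eventuallyConst_paramDeriv_x_sub (hτ : τ ∈ Icc 0 T) (h : 0 < p.x i Θ₀ τ) :
    EventuallyConst (paramDeriv (fun Θ t => p.x i Θ t - q.x i Θ t) Θ₀) (𝓝[Icc 0 T] τ) := by
  refine eventuallyConst_paramDeriv (c := fun s => p.a i s - q.a i s)
    (((p.isPrimitive_x hF i).and (q.isPrimitive_x hF i)).mono fun Θ h => h.1.sub h.2) ?_
  filter_upwards [p.eventually_x_pos hF hS hτ h, q.eventually_x_pos hF hS hτ (p.x_pos hF q hτ h)]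
    with s hp hq
  rw [Xdot_of_pos hp, Xdot_of_pos hq, sub_sub_sub_cancel_right]

theorem vanishingPropagates_x (hτ : τ ∈ Icc 0 T) : VanishingPropagates T (⋃ e, E e)
    (fun t => paramDeriv (p.x i) Θ₀ t - paramDeriv (q.x i) Θ₀ t) τ := by
  rcases ((p.state_self hF).x_nonneg i τ hτ).eq_or_lt with h0 | hpos
  · by_cases hl : τ ∈ E (.xiPlus i)
    · exact .inr ⟨mem_iUnion_of_mem _ hl,
        .inr ((p.hasNoJump_x hF hS hl).sub (q.hasNoJump_x hF hS hl))⟩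
    · have key : ∀ p : S.ObservedPath T F Θ₀ E, p.x i Θ₀ τ = 0 →
          (∀ᶠ u in 𝓝[Icc 0 T] τ, paramDeriv (p.x i) Θ₀ u = 0) ∨
          τ ∈ (⋃ e, E e) ∧ ∀ᶠ u in 𝓝[Ioc τ T] τ, paramDeriv (p.x i) Θ₀ u = 0 := fun p h0 =>
        (eventually_paramDeriv_eq_zero ((p.state_self hF).x_cont i) (p.eventually_x_nonneg hF i)
          (p.finite_hitsZero_x i) hτ h0 (mt (p.mem_iff (.xiPlus i)).2 hl)).imp_right
          (And.imp_left fun h => mem_iUnion_of_mem _ ((p.mem_iff (.xiZero i)).2 h))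
      exact vanishingPropagates_sub_of_eventually_eq_zero (key p h0.symm)
        (key q (p.x_eq_zero hF q hτ h0.symm))
  · refine .inl (((p.eventuallyConst_paramDeriv_x_sub q hF hS hτ hpos).anti
      (nhdsWithin_mono τ regularTimes_subset_Icc)).congr ?_)
    filter_upwards [self_mem_nhdsWithin] with t ht
    exact ((p.hasFDerivAt_x hF hS i ht).sub (q.hasFDerivAt_x hF hS i ht)).fderiv

theorem paramDeriv_x_eq (ht : t ∈ regularTimes T (⋃ e, E e)) :
    paramDeriv (p.x i) Θ₀ t = paramDeriv (q.x i) Θ₀ t := by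
  have hinit : ∀ p : S.ObservedPath T F Θ₀ E, (fun Θ => p.x i Θ 0) =ᶠ[𝓝 Θ₀] S.x₀ i := fun p => by
    filter_upwards [hF] with Θ hΘ using (p.state Θ hΘ).x_init i
  refine sub_eq_zero.1 (eq_zero_of_vanishingPropagates (T := T)
    (Δ := fun t => paramDeriv (p.x i) Θ₀ t - paramDeriv (q.x i) Θ₀ t) p.finite_iUnion ?_
    (fun τ hτ => p.vanishingPropagates_x q hF hS hτ) t ht)
  rw [paramDeriv, paramDeriv, (hinit p).fderiv_eq, (hinit q).fderiv_eq, sub_self]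

end TargetContent

section BoardContent

variable (p q : S.ObservedPath T F Θ₀ E)

theorem zRate_of_PB_eq_zero (h : S.PB j Θ t = 0) :
    p.zRate i j Θ t = S.inflow i j Θ t (p.a i t) (p.x i Θ t) := by
  rw [zRate, outflow_of_PB_eq_zero h, sub_zero]

theorem zRate_of_conn_ne (h : S.conn Θ t i ≠ some j) :
    p.zRate i j Θ t = -S.outflow i j Θ t (p.z i j Θ t) := by
  rw [zRate, inflow_of_conn_ne h, zero_sub]

variable (hF : F ∈ 𝓝 Θ₀) (hS : S.Admissible T F Θ₀)
include hF hS

theorem not_leavesZero_z (h : S.r i j < S.D i j Θ₀ τ) : ¬ LeavesZero T (p.z i j Θ₀) τ := by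
  intro hl
  have hτ : τ ∈ Icc 0 T := ⟨hl.1, hl.2.1.le⟩
  have hconn := (eventually_forall_Icc (eventually_of_eventually_prod
    (R := fun Θ s => S.conn Θ s i ≠ some j)
    (hS.eventually_conn_ne hF hτ h))).curry.self_of_nhdsWithin hτ
  obtain ⟨v, ⟨hv, hpos⟩, hτv, hvT⟩ := ((((eventually_nhdsWithin_Icc_iff hτ).1 hconn).2.2
    hl.2.1 |>.and hl.2.2.2).and (Ioc_mem_nhdsGT hl.2.1)).exists
  have hle := (p.isPrimitive_z hF hS i j).self_of_nhds.sub_le_mul_sub (c := 0) hτ.1 hτv.le hvT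
    fun s hs => by
      rw [p.zRate_of_conn_ne (hv s (Ioo_subset_Icc_self hs))]
      exact neg_nonpos.2 hS.outflow_nonneg
  linarith [hl.2.2.1]

theorem eventually_z_pos_of_leavesZero (hl : LeavesZero T (p.z i j Θ₀) τ) :
    ∀ᶠ u in 𝓝[>] τ, 0 < q.z i j Θ₀ u := by
  have hτ : τ ∈ Icc 0 T := ⟨hl.1, hl.2.1.le⟩
  by_cases hx : p.x i Θ₀ τ = 0
  · exact ((q.mem_iff (.zetaPlus i j)).1 ((p.mem_iff (.zetaPlus i j)).2 ⟨hl, hx⟩)).1.2.2.2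
  have hxpos := ((p.state_self hF).x_nonneg i τ hτ).lt_of_ne' hx
  have hD := not_lt.1 fun h => p.not_leavesZero_z hF hS h hl
  have hnear : ∀ᶠ s in 𝓝[Icc 0 T] τ, 0 < p.x i Θ₀ s ∧ 0 < q.x i Θ₀ s ∧ S.PB j Θ₀ s = 0 := by
    filter_upwards [((p.state_self hF).x_cont i τ hτ).eventually_const_lt hxpos,
      eventually_of_eventually_prod (R := fun Θ s => S.PB j Θ s = 0)
        (hS.eventually_PB_eq_zero hF hτ hD), self_mem_nhdsWithin] with s hs hPB hsI
      using ⟨hs, p.x_pos hF q hsI hs, hPB⟩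
  filter_upwards [((eventually_nhdsWithin_Icc_iff hτ).1
    ((eventually_forall_Icc hnear).curry.self_of_nhdsWithin hτ)).2.2 hl.2.1, hl.2.2.2,
    Ioc_mem_nhdsGT hl.2.1] with v hv hpos hτv
  have heq := (p.isPrimitive_z hF hS i j).self_of_nhds.sub_eq_sub
    (q.isPrimitive_z hF hS i j).self_of_nhds hτ.1 hτv.1.le hτv.2 fun s hs => by
      obtain ⟨hp, hq, hPB⟩ := hv s (Ioo_subset_Icc_self hs)
      rw [p.zRate_of_PB_eq_zero hPB, q.zRate_of_PB_eq_zero hPB, inflow_eq_of_pos hp hq]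
  linarith [hl.2.2.1, (q.state_self hF).z_nonneg i j τ hτ]

theorem z_pos (ht : t ∈ Icc 0 T) (h : 0 < p.z i j Θ₀ t) : 0 < q.z i j Θ₀ t := by
  have hp := p.state_self hF
  have hq := q.state_self hF
  refine pos_of_pos_of_hitsZero_of_leavesZero (hp.z_cont i j) (hp.z_nonneg i j) (hq.z_cont i j)
    (hq.z_nonneg i j) (fun h0 => ?_) (fun τ hτ => ?_)
    (fun τ hτ => p.eventually_z_pos_of_leavesZero q hF hS hτ) ht h
  · rwa [hq.z_init, ← hp.z_init]
  · exact (p.mem_iff (.zetaZero i j)).1 ((q.mem_iff (.zetaZero i j)).2 hτ)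

theorem z_eq_zero (ht : t ∈ Icc 0 T) (h : p.z i j Θ₀ t = 0) : q.z i j Θ₀ t = 0 :=
  ((q.state_self hF).z_nonneg i j t ht).eq_or_lt.elim Eq.symm fun h' =>
    absurd h (q.z_pos p hF hS ht h').ne'

theorem vanishingPropagates_z_of_zRate_eq
    (h : ∀ᶠ r in 𝓝 Θ₀ ×ˢ 𝓝[Icc 0 T] τ, p.zRate i j r.1 r.2 = q.zRate i j r.1 r.2) :
    VanishingPropagates T (⋃ e, E e)
      (fun t => paramDeriv (p.z i j) Θ₀ t - paramDeriv (q.z i j) Θ₀ t) τ := by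
  have hconst : EventuallyConst (paramDeriv (fun Θ t => p.z i j Θ t - q.z i j Θ t) Θ₀)
      (𝓝[Icc 0 T] τ) := eventuallyConst_paramDeriv (c := fun _ => 0)
    (((p.isPrimitive_z hF hS i j).and (q.isPrimitive_z hF hS i j)).mono fun Θ h => h.1.sub h.2)
    (h.mono fun r hr => sub_eq_zero.2 hr)
  refine .inl ((hconst.anti (nhdsWithin_mono τ regularTimes_subset_Icc)).congr ?_)
  filter_upwards [self_mem_nhdsWithin] with t ht
    using ((p.hasFDerivAt_z hF hS i j ht).sub (q.hasFDerivAt_z hF hS i j ht)).fderiv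

theorem vanishingPropagates_z_of_r_lt_D (hτ : τ ∈ Icc 0 T) (h : S.r i j < S.D i j Θ₀ τ) :
    VanishingPropagates T (⋃ e, E e)
      (fun t => paramDeriv (p.z i j) Θ₀ t - paramDeriv (q.z i j) Θ₀ t) τ := by
  rcases ((p.state_self hF).z_nonneg i j τ hτ).eq_or_lt with h0 | hpos
  · have key : ∀ p : S.ObservedPath T F Θ₀ E, p.z i j Θ₀ τ = 0 →
        (∀ᶠ u in 𝓝[Icc 0 T] τ, paramDeriv (p.z i j) Θ₀ u = 0) ∨
        τ ∈ (⋃ e, E e) ∧ ∀ᶠ u in 𝓝[Ioc τ T] τ, paramDeriv (p.z i j) Θ₀ u = 0 := fun p h0 =>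
      (eventually_paramDeriv_eq_zero ((p.state_self hF).z_cont i j) (p.eventually_z_nonneg hF i j)
        (p.finite_hitsZero_z i j) hτ h0 (p.not_leavesZero_z hF hS h)).imp_right
        (And.imp_left fun h => mem_iUnion_of_mem _ ((p.mem_iff (.zetaZero i j)).2 h))
    exact vanishingPropagates_sub_of_eventually_eq_zero (key p h0.symm)
      (key q (p.z_eq_zero q hF hS hτ h0.symm))
  · refine p.vanishingPropagates_z_of_zRate_eq q hF hS ?_
    filter_upwards [hS.eventually_conn_ne hF hτ h, p.eventually_z_pos hF hS hτ hpos,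
      q.eventually_z_pos hF hS hτ (p.z_pos q hF hS hτ hpos)] with r hc hp hq
    rw [p.zRate_of_conn_ne hc, q.zRate_of_conn_ne hc, outflow_of_pos hp, outflow_of_pos hq]

/-- Whatever the agents of `A` have not collected from target `i` is still there: as long as they
are the only ones to be connected to it, `∑ Z_il + X_i` grows at the arrival rate. -/
theorem eventuallyConst_sum_z_add_x (hτ : τ ∈ Icc 0 T) {A : Finset (Fin N)}
    (hA : ∀ᶠ r in 𝓝 Θ₀ ×ˢ 𝓝[Icc 0 T] τ, ∀ l, S.conn r.1 r.2 i = some l → l ∈ A)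
    (hD : ∀ l ∈ A, S.D i l Θ₀ τ ≤ S.r i l) :
    EventuallyConst (fun t => ∑ l ∈ A, paramDeriv (p.z i l) Θ₀ t + paramDeriv (p.x i) Θ₀ t)
      (𝓝[regularTimes T (⋃ e, E e)] τ) := by
  have hconst : EventuallyConst (paramDeriv (fun Θ t => ∑ l ∈ A, p.z i l Θ t + p.x i Θ t) Θ₀)
      (𝓝[Icc 0 T] τ) := by
    refine eventuallyConst_paramDeriv (c := p.a i)
      (((eventually_all.2 fun l => p.isPrimitive_z hF hS i l).and (p.isPrimitive_x hF i)).mono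
        fun Θ h => (IsPrimitive.sum fun l _ => h.1 l).add h.2) ?_
    filter_upwards [hA, (Finset.eventually_all A).2 fun l hl =>
      hS.eventually_PB_eq_zero hF hτ (hD l hl), tendsto_snd.eventually eventually_mem_nhdsWithin]
      with r hr hPB hrT
    rw [Finset.sum_congr rfl fun l hl => p.zRate_of_PB_eq_zero (hPB l hl),
      hS.sum_inflow (p.arrival_nonneg i _ hrT) hr, sub_add_cancel]
  refine (hconst.anti (nhdsWithin_mono τ regularTimes_subset_Icc)).congr ?_
  filter_upwards [self_mem_nhdsWithin] with t ht
    using ((HasFDerivAt.fun_sum fun l _ => p.hasFDerivAt_z hF hS i l ht).add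
      (p.hasFDerivAt_x hF hS i ht)).fderiv

omit hS in
theorem eventually_paramDeriv_x_eq_zero (h0 : ∀ᶠ u in 𝓝[Icc 0 T] τ, p.x i Θ₀ u = 0) :
    ∀ᶠ u in 𝓝[Icc 0 T] τ, paramDeriv (p.x i) Θ₀ u = 0 := by
  filter_upwards [h0, self_mem_nhdsWithin] with u hu huI
    using paramDeriv_eq_zero ((p.eventually_x_nonneg hF i).mono fun Θ h => h u huI) hu

/-- An agent that is not connected on either side of `τ` collects nothing under `Θ₀`, so the amount
collected across `τ` is minimal at `Θ₀`. -/
theorem hasNoJump_z_of_conn_ne (hτ : τ ∈ Icc 0 T) (hD : S.D i j Θ₀ τ ≤ S.r i j)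
    (hconn : ∀ᶠ s in 𝓝[Icc 0 T] τ, s ≠ τ → S.conn Θ₀ s i ≠ some j) :
    HasNoJump T (⋃ e, E e) (paramDeriv (p.z i j) Θ₀) τ := by
  refine hasNoJump_of_eventually_eq ?_
  filter_upwards [eventually_mem_across, across_le (eventually_forall_Icc hconn),
    across_le (eventually_forall_Icc_of_eventually_prod (R := fun Θ s => S.PB j Θ s = 0)
      (hS.eventually_PB_eq_zero hF hτ hD))] with ⟨u, v⟩ ⟨hu, hv⟩ hc hPB
  have hprim := (p.isPrimitive_z hF hS i j).self_of_nhds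
  have hrate : ∀ s ∈ Icc u v, s ≠ τ → p.zRate i j Θ₀ s ≤ 0 := fun s hs hne => by
    rw [p.zRate_of_conn_ne (hc s hs hne)]
    exact neg_nonpos.2 hS.outflow_nonneg
  have hbefore := hprim.sub_le_mul_sub hu.1.1.1 hu.2 hτ.2 fun s hs =>
    hrate s ⟨hs.1.le, hs.2.le.trans hv.2.le⟩ hs.2.ne
  have hafter := hprim.sub_le_mul_sub hτ.1 hv.2.le hv.1.1.2 fun s hs =>
    hrate s ⟨hu.2.trans hs.1.le, hs.2.le⟩ hs.1.ne'
  have hmin : IsLocalMin (fun Θ => p.z i j Θ v - p.z i j Θ u) Θ₀ := by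
    filter_upwards [hPB, p.isPrimitive_z hF hS i j] with Θ hΘ hprim
    have hcoll := hprim.neg.sub_le_mul_sub (c := 0) hu.1.1.1 (hu.2.trans hv.2.le) hv.1.1.2
      fun s hs => by
        rw [p.zRate_of_PB_eq_zero (hΘ s (Ioo_subset_Icc_self hs))]
        exact neg_nonpos.2 (hS.inflow_nonneg (p.arrival_nonneg i s
          ⟨hu.1.1.1.trans hs.1.le, hs.2.le.trans hv.1.1.2⟩))
    linarith
  exact (sub_eq_zero.1 (hmin.hasFDerivAt_eq_zero
    ((p.hasFDerivAt_z hF hS i j hv.1).sub (p.hasFDerivAt_z hF hS i j hu.1)))).symm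

omit hF in
theorem z_add_x_sub_le_of_conn_eq {u v : ℝ} (hΘ₀ : Θ₀ ∈ F) (hΘ : Θ ∈ F) (hu : 0 ≤ u)
    (huv : u ≤ v) (hv : v ≤ T) (hPB : ∀ s ∈ Ioo u v, S.PB j Θ s = 0 ∧ S.PB j Θ₀ s = 0)
    (hconn : ∀ s ∈ Ioo u v, S.conn Θ₀ s i = some j) :
    p.z i j Θ v + p.x i Θ v - (p.z i j Θ₀ v + p.x i Θ₀ v) ≤
      p.z i j Θ u + p.x i Θ u - (p.z i j Θ₀ u + p.x i Θ₀ u) := by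
  have h := fun Θ hΘ => ((p.state Θ hΘ).isPrimitive_z hS hΘ p.arrival_nonneg i j).add
    ((p.state Θ hΘ).isPrimitive_x i)
  have hle := ((h Θ hΘ).sub (h Θ₀ hΘ₀)).sub_le_mul_sub (c := 0) hu huv hv fun s hs => by
    have ha := p.arrival_nonneg i s ⟨hu.trans hs.1.le, hs.2.le.trans hv⟩
    rw [← zRate, ← zRate, p.zRate_of_PB_eq_zero (hPB s hs).1, p.zRate_of_PB_eq_zero (hPB s hs).2,
      hS.inflow_of_conn_eq (hconn s hs) ha]
    linarith [hS.inflow_le_sub_Xdot (i := i) (j := j) (Θ := Θ) (t := s) (x := p.x i Θ s) ha]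
  linarith

omit hF in
theorem z_sub_le_of_r_lt_D {u v K : ℝ} (hΘ₀ : Θ₀ ∈ F) (hΘ : Θ ∈ F) (hu : 0 ≤ u)
    (huv : u ≤ v) (hv : v ≤ T)
    (hK : ∀ t ∈ Icc 0 T, |S.μ i j * S.P i j Θ t - S.μ i j * S.P i j Θ₀ t| ≤ K * ‖Θ - Θ₀‖)
    (hPB : ∀ s ∈ Ioo u v, S.PB j Θ s = 0 ∧ S.PB j Θ₀ s = 0)
    (hD : ∀ s ∈ Ioo u v, S.r i j < S.D i j Θ₀ s) :
    p.z i j Θ v - p.z i j Θ₀ v - (p.z i j Θ u - p.z i j Θ₀ u) ≤ K * ‖Θ - Θ₀‖ * (v - u) := by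
  have h := fun Θ hΘ => (p.state Θ hΘ).isPrimitive_z hS hΘ p.arrival_nonneg i j
  refine ((h Θ hΘ).sub (h Θ₀ hΘ₀)).sub_le_mul_sub hu huv hv fun s hs => ?_
  have hsT : s ∈ Icc 0 T := ⟨hu.trans hs.1.le, hs.2.le.trans hv⟩
  have hP := (abs_le.1 (hK s hsT)).2
  rw [hS.P_eq_zero (hD s hs), mul_zero, sub_zero] at hP
  rw [← zRate, ← zRate, p.zRate_of_PB_eq_zero (hPB s hs).1, p.zRate_of_PB_eq_zero (hPB s hs).2,
    inflow_of_conn_ne (hS.conn_ne_of_lt hΘ₀ hsT (hD s hs)), sub_zero]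
  exact hS.inflow_le.trans hP

/-- Before `τ` the agent collects everything that arrives, which no other parameter can exceed by
more than the content `X_i`; after `τ` it is out of range under `Θ₀`, so its rate is
`O(‖Θ - Θ₀‖)`. -/
theorem hasNoJump_z_of_disconnects (h0 : 0 < τ) (hτ : τ ≤ T) (hD : S.D i j Θ₀ τ ≤ S.r i j)
    (hx : ∀ᶠ u in 𝓝[Icc 0 T] τ, p.x i Θ₀ u = 0)
    (hbefore : ∀ᶠ s in 𝓝[Icc 0 T] τ, s < τ → S.conn Θ₀ s i = some j)
    (hafter : ∀ᶠ s in 𝓝[Icc 0 T] τ, τ < s → S.conn Θ₀ s i ≠ some j) :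
    HasNoJump T (⋃ e, E e) (paramDeriv (p.z i j) Θ₀) τ := by
  have hτI : τ ∈ Icc 0 T := ⟨h0.le, hτ⟩
  have hx₀ : p.x i Θ₀ τ = 0 := hx.self_of_nhdsWithin hτI
  have hout := hS.eventually_r_lt_D_of_disconnects hF (p.finite_hitsZero_Dplus i j) h0 hτ hD
    hbefore hafter
  obtain ⟨K, hK, hle⟩ := hS.exists_mul_P_sub_le i j
  refine hasNoJump_of_sub_le (Θ₀ := Θ₀) hK ?_
  filter_upwards [eventually_mem_across, across_le (eventually_forall_Icc (hbefore.and hout)),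
    across_le (eventually_forall_Icc_of_eventually_prod (R := fun Θ s => S.PB j Θ s = 0)
      (hS.eventually_PB_eq_zero hF hτI hD)),
    across_le ((hx.and (p.eventually_paramDeriv_x_eq_zero hF hx)).prod_inl (𝓝[Icc 0 T] τ))]
    with ⟨u, v⟩ ⟨hu, hv⟩ hc hPB ⟨hxu, hdxu⟩
  refine ⟨fun Θ => p.z i j Θ v - p.z i j Θ u - p.x i Θ u, ?_, ?_⟩
  · have := ((p.hasFDerivAt_z hF hS i j hv.1).sub (p.hasFDerivAt_z hF hS i j hu.1)).sub
      (p.hasFDerivAt_x hF hS i hu.1)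
    rwa [hdxu, sub_zero] at this
  filter_upwards [hF, hPB, hle, p.eventually_x_nonneg hF i] with Θ hΘF hΘ hleΘ hnn
  have hl : Ioo u τ ⊆ Icc u v := fun s hs => ⟨hs.1.le, hs.2.le.trans hv.2.le⟩
  have hr : Ioo τ v ⊆ Icc u v := fun s hs => ⟨hu.2.trans hs.1.le, hs.2.le⟩
  have hbefore := p.z_add_x_sub_le_of_conn_eq hS (mem_of_mem_nhds hF) hΘF hu.1.1.1 hu.2 hτ
    (fun s hs => ⟨hΘ s (hl hs), hPB.self_of_nhds s (hl hs)⟩) fun s hs => (hc s (hl hs)).1 hs.2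
  have hafter := p.z_sub_le_of_r_lt_D hS (mem_of_mem_nhds hF) hΘF h0.le hv.2.le hv.1.1.2 hleΘ
    (fun s hs => ⟨hΘ s (hr hs), hPB.self_of_nhds s (hr hs)⟩) fun s hs => (hc s (hr hs)).2 hs.1
  have huτ : K * ‖Θ - Θ₀‖ * (v - τ) ≤ K * ‖Θ - Θ₀‖ * (v - u) := by gcongr; exact hu.2
  linarith [hnn τ hτI, show p.x i Θ₀ u = 0 from hxu]

end BoardContent

section BoardContentPropagation

variable (p q : S.ObservedPath T F Θ₀ E)

include p in
theorem exists_conn_eq_before_after (hS : S.Admissible T F Θ₀) (hτ : τ ∈ Icc 0 T) :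
    ∃ c₁ c₂ : Option (Fin N), ∀ᶠ s in 𝓝[Icc 0 T] τ,
      (s < τ → S.conn Θ₀ s i = c₁) ∧ (τ < s → S.conn Θ₀ s i = c₂) := by
  have hloc : ∀ t ∈ Ioo 0 T, t ∉ ⋃ e, E e → EventuallyConst (fun s => S.conn Θ₀ s i) (𝓝 t) := by
    intro t ht htE
    have h := eventually_of_eventually_prod (R := fun Θ s => S.conn Θ s i = S.conn Θ₀ t i)
      (hS.eventually_conn_eq (Ioo_subset_Icc_self ht) (p.not_delta fun j =>
        ⟨fun h => htE (mem_iUnion_of_mem _ h), fun h => htE (mem_iUnion_of_mem _ h)⟩))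
    rw [nhdsWithin_eq_nhds.2 (Icc_mem_nhds ht.1 ht.2)] at h
    exact eventuallyConst_iff_exists_eventuallyEq.2 ⟨_, h⟩
  obtain ⟨h₁, h₂⟩ := eventuallyConst_nhdsLT_and_nhdsGT p.finite_iUnion hloc hτ
  obtain ⟨c₁, hc₁⟩ := eventuallyConst_iff_exists_eventuallyEq.1 h₁
  obtain ⟨c₂, hc₂⟩ := eventuallyConst_iff_exists_eventuallyEq.1 h₂
  refine ⟨c₁, c₂, ?_⟩
  filter_upwards [nhdsWithin_le_nhds (eventually_nhdsWithin_iff.1 hc₁),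
    nhdsWithin_le_nhds (eventually_nhdsWithin_iff.1 hc₂), self_mem_nhdsWithin] with s h₁ h₂ hs
    using ⟨fun h => h₁ ⟨hs.1, h⟩, fun h => h₂ ⟨h, hs.2⟩⟩

variable (hF : F ∈ 𝓝 Θ₀) (hS : S.Admissible T F Θ₀)
include hF hS

theorem hasNoJump_z_of_conn_ne_after (hτ : τ ∈ Icc 0 T) (hD : S.D i j Θ₀ τ ≤ S.r i j)
    (hx : ∀ᶠ u in 𝓝[Icc 0 T] τ, p.x i Θ₀ u = 0)
    (hafter : ∀ᶠ s in 𝓝[Icc 0 T] τ, τ < s → S.conn Θ₀ s i ≠ some j) :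
    HasNoJump T (⋃ e, E e) (paramDeriv (p.z i j) Θ₀) τ := by
  obtain ⟨c, _, hc⟩ := p.exists_conn_eq_before_after (i := i) hS hτ
  by_cases h : 0 < τ ∧ c = some j
  · exact p.hasNoJump_z_of_disconnects hF hS h.1 hτ.2 hD hx
      (hc.mono fun s hs hlt => (hs.1 hlt).trans h.2) hafter
  · refine p.hasNoJump_z_of_conn_ne hF hS hτ hD ?_
    filter_upwards [hc, hafter, self_mem_nhdsWithin] with s hs hs' hsI hne
    rcases hne.lt_or_gt with hlt | hgt
    · exact fun heq => h ⟨hsI.1.trans_lt hlt, (hs.1 hlt).symm.trans heq⟩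
    · exact hs' hgt

/-- If an agent in range is not the one that is connected after `τ`, it either was not connected
before or disconnects at `τ`. The content of the agent that is connected is recovered from
the total content of the agents in range. -/
theorem hasNoJump_z (hτ : τ ∈ Icc 0 T) (hD : S.D i j Θ₀ τ ≤ S.r i j)
    (hx : ∀ᶠ u in 𝓝[Icc 0 T] τ, p.x i Θ₀ u = 0) :
    HasNoJump T (⋃ e, E e) (paramDeriv (p.z i j) Θ₀) τ := by
  classical
  obtain ⟨_, c, hc⟩ := p.exists_conn_eq_before_after (i := i) hS hτ
  by_cases hcj : c = some j
  swap
  · exact p.hasNoJump_z_of_conn_ne_after hF hS hτ hD hx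
      (hc.mono fun s hs hlt => (hs.2 hlt).trans_ne hcj)
  set A : Finset (Fin N) := Finset.univ.filter fun l => S.D i l Θ₀ τ ≤ S.r i l
  have hA : ∀ l ∈ A, S.D i l Θ₀ τ ≤ S.r i l := fun l hl => (Finset.mem_filter.1 hl).2
  have hconn : ∀ᶠ r in 𝓝 Θ₀ ×ˢ 𝓝[Icc 0 T] τ, ∀ l, S.conn r.1 r.2 i = some l → l ∈ A := by
    refine eventually_all.2 fun l => ?_
    by_cases hl : S.D i l Θ₀ τ ≤ S.r i l
    · exact .of_forall fun _ _ => Finset.mem_filter.2 ⟨Finset.mem_univ l, hl⟩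
    · filter_upwards [hS.eventually_conn_ne hF hτ (not_le.1 hl)] with r hr h using absurd h hr
  have htotal : HasNoJump T (⋃ e, E e) (fun t => ∑ l ∈ A, paramDeriv (p.z i l) Θ₀ t) τ := by
    refine hasNoJump_of_eventuallyConst
      ((p.eventuallyConst_sum_z_add_x hF hS hτ hconn hA).congr ?_)
    filter_upwards [(p.eventually_paramDeriv_x_eq_zero hF hx).filter_mono
      (nhdsWithin_mono τ regularTimes_subset_Icc)] with t ht
    rw [ht, add_zero]
  have hothers := HasNoJump.sum (A := A.erase j) fun l hl =>
    p.hasNoJump_z_of_conn_ne_after hF hS hτ (hA l (Finset.mem_of_mem_erase hl)) hx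
      (hc.mono fun s hs hlt h => Finset.ne_of_mem_erase hl
        (Option.some.inj (h.symm.trans ((hs.2 hlt).trans hcj))))
  convert htotal.sub hothers using 2 with t
  rw [← Finset.add_sum_erase A _ (Finset.mem_filter.2 ⟨Finset.mem_univ j, hD⟩),
    add_sub_cancel_right]

theorem vanishingPropagates_z_of_pos (hτ : τ ∈ Icc 0 T) (hD : S.D i j Θ₀ τ ≤ S.r i j)
    (hx : 0 < p.x i Θ₀ τ) : VanishingPropagates T (⋃ e, E e)
      (fun t => paramDeriv (p.z i j) Θ₀ t - paramDeriv (q.z i j) Θ₀ t) τ := by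
  refine p.vanishingPropagates_z_of_zRate_eq q hF hS ?_
  filter_upwards [hS.eventually_PB_eq_zero hF hτ hD, p.eventually_x_pos hF hS hτ hx,
    q.eventually_x_pos hF hS hτ (p.x_pos hF q hτ hx)] with r hPB hp hq
  rw [p.zRate_of_PB_eq_zero hPB, q.zRate_of_PB_eq_zero hPB, inflow_eq_of_pos hp hq]

theorem vanishingPropagates_z_of_conn_eq (hτ : τ ∈ Icc 0 T) (hD : S.D i j Θ₀ τ ≤ S.r i j)
    (hconn : ∀ᶠ r in 𝓝 Θ₀ ×ˢ 𝓝[Icc 0 T] τ, S.conn r.1 r.2 i = some j) :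
    VanishingPropagates T (⋃ e, E e)
      (fun t => paramDeriv (p.z i j) Θ₀ t - paramDeriv (q.z i j) Θ₀ t) τ := by
  have h : ∀ p : S.ObservedPath T F Θ₀ E, EventuallyConst (fun t => ∑ l ∈ {j},
      paramDeriv (p.z i l) Θ₀ t + paramDeriv (p.x i) Θ₀ t) (𝓝[regularTimes T (⋃ e, E e)] τ) :=
    fun p => p.eventuallyConst_sum_z_add_x hF hS hτ (hconn.mono fun r hr l hl =>
      Finset.mem_singleton.2 (Option.some.inj (hl.symm.trans hr)))
      fun l hl => (Finset.mem_singleton.1 hl).symm ▸ hD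
  refine .inl (((h p).comp₂ (· - ·) (h q)).congr ?_)
  filter_upwards [self_mem_nhdsWithin] with t ht
  simp only [Finset.sum_singleton, p.paramDeriv_x_eq q hF hS ht, add_sub_add_right_eq_sub]

theorem vanishingPropagates_z (hτ : τ ∈ Icc 0 T) : VanishingPropagates T (⋃ e, E e)
    (fun t => paramDeriv (p.z i j) Θ₀ t - paramDeriv (q.z i j) Θ₀ t) τ := by
  rcases lt_or_ge (S.r i j) (S.D i j Θ₀ τ) with hD | hD
  · exact p.vanishingPropagates_z_of_r_lt_D q hF hS hτ hD
  rcases ((p.state_self hF).x_nonneg i τ hτ).lt_or_eq with hx | hx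
  · exact p.vanishingPropagates_z_of_pos q hF hS hτ hD hx
  by_cases hδ : ∀ l, τ ∉ E (.deltaZero i l) ∧ τ ∉ E (.deltaPlus i l)
  · have hconn := hS.eventually_conn_eq hτ (p.not_delta hδ)
    by_cases hj : S.conn Θ₀ τ i = some j
    · exact p.vanishingPropagates_z_of_conn_eq q hF hS hτ hD (hconn.mono fun r hr => hr.trans hj)
    · refine p.vanishingPropagates_z_of_zRate_eq q hF hS ?_
      filter_upwards [hconn, hS.eventually_PB_eq_zero hF hτ hD] with r hr hPB
      rw [p.zRate_of_PB_eq_zero hPB, q.zRate_of_PB_eq_zero hPB,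
        inflow_of_conn_ne (hr.trans_ne hj), inflow_of_conn_ne (hr.trans_ne hj)]
  · obtain ⟨e, he, hζ, hξ, hξ'⟩ : ∃ e, τ ∈ E e ∧ (∀ i j, e ≠ .zetaPlus i j) ∧
        e ≠ .xiZero i ∧ e ≠ .xiPlus i := by
      simp only [not_forall, not_and_or, not_not] at hδ
      obtain ⟨l, h | h⟩ := hδ
      exacts [⟨_, h, nofun, nofun, nofun⟩, ⟨_, h, nofun, nofun, nofun⟩]
    have hnear : ∀ p : S.ObservedPath T F Θ₀ E, p.x i Θ₀ τ = 0 →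
        ∀ᶠ u in 𝓝[Icc 0 T] τ, p.x i Θ₀ u = 0 := fun p h =>
      p.eventually_x_eq_zero hF hτ h (fun h' => hξ (p.simple _ _ hζ nofun τ he h'))
        fun h' => hξ' (p.simple _ _ hζ nofun τ he h')
    exact .inr ⟨mem_iUnion_of_mem e he, .inr ((p.hasNoJump_z hF hS hτ hD (hnear p hx.symm)).sub
      (q.hasNoJump_z hF hS hτ hD (hnear q (p.x_eq_zero hF q hτ hx.symm))))⟩

theorem paramDeriv_z_eq (ht : t ∈ regularTimes T (⋃ e, E e)) :
    paramDeriv (p.z i j) Θ₀ t = paramDeriv (q.z i j) Θ₀ t := by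
  have hinit : ∀ p : S.ObservedPath T F Θ₀ E, (fun Θ => p.z i j Θ 0) =ᶠ[𝓝 Θ₀] S.z₀ i j :=
    fun p => by filter_upwards [hF] with Θ hΘ using (p.state Θ hΘ).z_init i j
  refine sub_eq_zero.1 (eq_zero_of_vanishingPropagates (T := T)
    (Δ := fun t => paramDeriv (p.z i j) Θ₀ t - paramDeriv (q.z i j) Θ₀ t) p.finite_iUnion ?_
    (fun τ hτ => p.vanishingPropagates_z q hF hS hτ) t ht)
  rw [paramDeriv, paramDeriv, (hinit p).fderiv_eq, (hinit q).fderiv_eq, sub_self]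

end BoardContentPropagation

/-- Both sides are the amount that arrives at target `i` up to time `t`. -/
theorem content_sub_initialContent (p : S.ObservedPath T F Θ₀ E) (hS : S.Admissible T F Θ₀)
    {Θ₁ Θ₂ : Params d} (h₁ : Θ₁ ∈ F) (h₂ : Θ₂ ∈ F) (i : Fin M) (ht : t ∈ Icc 0 T) :
    p.x i Θ₁ t + ∑ j, p.z i j Θ₁ t + p.y i Θ₁ t - S.initialContent i Θ₁ =
      p.x i Θ₂ t + ∑ j, p.z i j Θ₂ t + p.y i Θ₂ t - S.initialContent i Θ₂ := by
  have hprim := fun Θ (hΘ : Θ ∈ F) =>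
    (((p.state Θ hΘ).isPrimitive_x i).add (IsPrimitive.sum (A := Finset.univ) fun j _ =>
      (p.state Θ hΘ).isPrimitive_z hS hΘ p.arrival_nonneg i j)).add ((p.state Θ hΘ).isPrimitive_y i)
  have hinit : ∀ Θ ∈ F, p.x i Θ 0 + ∑ j, p.z i j Θ 0 + p.y i Θ 0 = S.initialContent i Θ :=
    fun Θ hΘ => by
      simp only [(p.state Θ hΘ).x_init, (p.state Θ hΘ).z_init, (p.state Θ hΘ).y_init,
        initialContent]
  rw [← hinit Θ₁ h₁, ← hinit Θ₂ h₂]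
  refine (hprim Θ₁ h₁).sub_eq_sub (hprim Θ₂ h₂) le_rfl ht.1 ht.2 fun s hs => ?_
  have ha := p.arrival_nonneg i s ⟨hs.1.le, hs.2.le.trans ht.2⟩
  simp only [Finset.sum_sub_distrib, hS.sum_inflow ha fun j _ => Finset.mem_univ j]
  ring

theorem hasFDerivAt_y (p : S.ObservedPath T F Θ₀ E) (hF : F ∈ 𝓝 Θ₀) (hS : S.Admissible T F Θ₀)
    (i : Fin M) (ht : t ∈ regularTimes T (⋃ e, E e)) :
    HasFDerivAt (fun Θ => p.y i Θ t) (fderiv ℝ (S.initialContent i) Θ₀ -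
      (paramDeriv (p.x i) Θ₀ t + ∑ j, paramDeriv (p.z i j) Θ₀ t)) Θ₀ := by
  have hinit : HasFDerivAt (S.initialContent i) (fderiv ℝ (S.initialContent i) Θ₀) Θ₀ :=
    (((hS.x₀_diff i).add (.fun_sum fun j _ => hS.z₀_diff i j)).add (hS.y₀_diff i)).hasFDerivAt
  refine ((hinit.sub ((p.hasFDerivAt_x hF hS i ht).add
    (HasFDerivAt.fun_sum fun j _ => p.hasFDerivAt_z hF hS i j ht))).const_add
    (p.x i Θ₀ t + ∑ j, p.z i j Θ₀ t + p.y i Θ₀ t - S.initialContent i Θ₀)).congr_of_eventuallyEq ?_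
  filter_upwards [hF] with Θ hΘ
  have := p.content_sub_initialContent hS hΘ (mem_of_mem_nhds hF) i ht.1
  simp only [Pi.sub_apply, Pi.add_apply]
  linarith

end ObservedPath

theorem exists_paramDeriv_eq (hF : F ∈ 𝓝 Θ₀) (hS : S.Admissible T F Θ₀)
    (E : Event M N → Set ℝ) :
    ∃ (DX : Fin M → ℝ → Params d →L[ℝ] ℝ) (DZ : Fin M → Fin N → ℝ → Params d →L[ℝ] ℝ),
      ∀ p : S.ObservedPath T F Θ₀ E, ∀ t ∈ regularTimes T (⋃ e, E e),
        (∀ i, paramDeriv (p.x i) Θ₀ t = DX i t) ∧ ∀ i j, paramDeriv (p.z i j) Θ₀ t = DZ i j t := by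
  rcases isEmpty_or_nonempty (S.ObservedPath T F Θ₀ E) with h | ⟨⟨q⟩⟩
  · exact ⟨0, 0, fun p => h.elim p⟩
  · exact ⟨fun i => paramDeriv (q.x i) Θ₀, fun i j => paramDeriv (q.z i j) Θ₀, fun p t ht =>
      ⟨fun i => p.paramDeriv_x_eq q hF hS ht, fun i j => p.paramDeriv_z_eq q hF hS ht⟩⟩

end Setting

theorem corollary1_general {M N : ℕ} {d : Fin N → ℕ} (S : Setting M N d) (T : ℝ)
    (F : Set (Params d)) (Θ₀ : Params d) (hF : F ∈ 𝓝 Θ₀) (hS : S.Admissible T F Θ₀) :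
    ∃ (ΦX : (Event M N → Set ℝ) → Fin M → ℝ → (Params d →L[ℝ] ℝ))
      (ΦZ : (Event M N → Set ℝ) → Fin M → Fin N → ℝ → (Params d →L[ℝ] ℝ))
      (ΦY : (Event M N → Set ℝ) → Fin M → ℝ → (Params d →L[ℝ] ℝ)),
      ∀ (E : Event M N → Set ℝ) (p : S.ObservedPath T F Θ₀ E),
        ∀ t ∈ Icc 0 T, (∀ e, t ∉ E e) →
          (∀ i, HasFDerivAt (fun Θ => p.x i Θ t) (ΦX E i t) Θ₀) ∧
          (∀ i j, HasFDerivAt (fun Θ => p.z i j Θ t) (ΦZ E i j t) Θ₀) ∧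
          (∀ i, HasFDerivAt (fun Θ => p.y i Θ t) (ΦY E i t) Θ₀) := by
  choose ΦX ΦZ hΦ using Setting.exists_paramDeriv_eq hF hS
  refine ⟨ΦX, ΦZ, fun E i t => fderiv ℝ (S.initialContent i) Θ₀ - (ΦX E i t + ∑ j, ΦZ E i j t),
    fun E p t ht htE => ?_⟩
  have htR : t ∈ regularTimes T (⋃ e, E e) := ⟨ht, .inr (by simpa only [mem_iUnion, not_exists])⟩
  obtain ⟨hX, hZ⟩ := hΦ E p t htR
  simp only [← hX, ← hZ]
  exact ⟨fun i => p.hasFDerivAt_x hF hS i htR, fun i j => p.hasFDerivAt_z hF hS i j htR,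
    fun i => p.hasFDerivAt_y hF hS i htR⟩

end DataHarvesting

open DataHarvesting in
theorem corollary1 {M N : ℕ} {d : Fin N → ℕ} (S : Setting M N d) (T : ℝ) (hT : 0 < T)
    (F : Set (Params d)) (Θ₀ : Params d) (hF : F ∈ 𝓝 Θ₀) (hS : S.Admissible T F Θ₀) :
    ∃ (ΦX : (Event M N → Set ℝ) → Fin M → ℝ → (Params d →L[ℝ] ℝ))
      (ΦZ : (Event M N → Set ℝ) → Fin M → Fin N → ℝ → (Params d →L[ℝ] ℝ))
      (ΦY : (Event M N → Set ℝ) → Fin M → ℝ → (Params d →L[ℝ] ℝ)),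
      ∀ (Ω : Type*) [MeasurableSpace Ω] (ℙ : Measure Ω) [IsProbabilityMeasure ℙ]
        (σ : Fin M → ℝ → Ω → ℝ)
        (X : Fin M → Params d → ℝ → Ω → ℝ)
        (Z : Fin M → Fin N → Params d → ℝ → Ω → ℝ)
        (Y : Fin M → Params d → ℝ → Ω → ℝ),
        (∀ i t, Measurable (σ i t)) →
        (∀ᵐ ω ∂ℙ, S.IsSamplePath T F Θ₀ (fun i t => σ i t ω) (fun i Θ t => X i Θ t ω)
          (fun i j Θ t => Z i j Θ t ω) (fun i Θ t => Y i Θ t ω)) →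
        ∀ᵐ ω ∂ℙ, ∀ E : Event M N → Set ℝ,
          E = S.eventTimes T Θ₀ (fun i t => X i Θ₀ t ω) (fun i j t => Z i j Θ₀ t ω) →
          ∀ t ∈ Icc 0 T, (∀ e, t ∉ E e) →
            (∀ i, HasFDerivAt (fun Θ => X i Θ t ω) (ΦX E i t) Θ₀) ∧
            (∀ i j, HasFDerivAt (fun Θ => Z i j Θ t ω) (ΦZ E i j t) Θ₀) ∧
            (∀ i, HasFDerivAt (fun Θ => Y i Θ t ω) (ΦY E i t) Θ₀) := by
  obtain ⟨ΦX, ΦZ, ΦY, h⟩ := corollary1_general S T F Θ₀ hF hS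
  refine ⟨ΦX, ΦZ, ΦY, fun Ω _ ℙ _ σ X Z Y _ hpath => hpath.mono fun ω hω E hE => ?_⟩
  subst hE
  exact h _ ⟨_, _, _, _, hω.arrival_nonneg, hω.state, rfl, hω.finite, hω.simple, hω.diff⟩
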